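/- Let $N\ge 1$, $B$, $d$ be integers. Consider the problem $$\text{(P)}\qquad \min_{\mathbf x}\; U(\mathbf x)=\sum_{i=1}^N f_i(\mathbf x)+\sum_{\ell=1}^B g_\ell(\mathbf x_\ell)\quad\text{subject to } \mathbf x_\ell\in\mathcal K_\ell,\ \ell=1,\dots,B,$$ where $\mathbf x=(\mathbf x_1,\dots,\mathbf x_B)$, $\mathbf x_\ell\in\mathbb R^d$, and let $\mathcal K=\mathcal K_1\times\cdots\times\mathcal K_B$. Assume: each $\mathcal K_\ell$ is nonempty, closed and convex; each $f_i$ is $C^1$ on an open set containing $\mathcal K$, and $\nabla f_i$ is Lipschitz continuous and bounded on $\mathcal K$; each $g_\ell$ is convex on an open (convex) set containing $\mathcal K_\ell$, with bounded subgradients over $\mathcal K_\ell$; and $U(\mathbf x)\to\infty$ as $\|\mathbf x\|\to\infty$, $\mathbf x\in\mathcal K$. Let $\mathcal G$ be a strongly connected directed graph on $\{1,\dots,N\}$, let $\mathcal N_i$ be the set of in-neighbors of $i$, including $i$, and let $\ell_i^t\in\{1,\dots,B\}$ be the block selected by agent $i$ at time $t\ge0$. Assume that for each $i$ there is $T_i>0$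 with $\bigcup_{s=0}^{T_i-1}\{\ell_i^{t+s}\}=\{1,\dots,B\}$ for all $t\ge 0$. Put $\mathcal N_{i,\ell}^t=\{j\in\mathcal N_i:\ell_j^t=\ell\}\cup\{i\}$. Let the matrices $\mathbf A_\ell^t=[a_{ij\ell}^t]_{i,j=1}^N$ be column stochastic and such that, for some $\theta\in(0,1)$ and all $t,\ell,i,j$, $a_{ij\ell}^t\in[\theta,1]$ if $j\in\mathcal N_{i,\ell}^t$ and $a_{ij\ell}^t=0$ otherwise. Let the surrogates $\tilde f_{i,\ell}:\mathcal K_\ell\times\mathcal K\to\mathbb R$ be differentiable in the first argument, with partial gradient $\nabla\tilde f_{i,\ell}$, and such that: $\tilde f_{i,\ell}(\bullet;\mathbf x)$ is strongly convex on $\mathcal K_\ell$ with a constant $\tau_i>0$ independent of $\mathbf x\in\mathcal K$ and of $\ell$; $\nabla\tilde f_{i,\ell}(\mathbf x_\ell;\mathbf x)=\nabla_\ell f_i(\mathbf x)$ for all $\mathbf x\in\mathcal K$; and $\nabla\tilde f_{i,\ell}(\mathbf u;\bullet)$ is Lipschitz continuous on $\mathcal K$, uniformly in $\mathbf u\in\mathcal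 K_\ell$. Let $0<\gamma^t\le1$ satisfy $\eta\gamma^t\le\gamma^{t+1}\le\gamma^t$ for all $t\ge 0$ and some $\eta\in(0,1)$, $\sum_t\gamma^t=\infty$ and $\sum_t(\gamma^t)^2<\infty$. Let the sequences be generated by Block-SONATA: for each agent $i$, start from an arbitrary $\mathbf x_{(i)}^0\in\mathcal K$, with $\phi_{(i,\ell)}^0=1$ for all $\ell$, $\mathbf y_{(i)}^0=\nabla f_i(\mathbf x_{(i)}^0)$, and an arbitrary $\tilde{\boldsymbol\pi}_{(i)}^0\in\mathbb R^{dB}$; for every $t\ge0$, with $\ell=\ell_i^t$, let $$\tilde{\mathbf x}_{(i,\ell)}^t=\operatorname*{argmin}_{\mathbf u\in\mathcal K_\ell}\ \tilde f_{i,\ell}(\mathbf u;\mathbf x_{(i)}^t)+(\mathbf u-\mathbf x_{(i,\ell)}^t)^\top\tilde{\boldsymbol\pi}_{(i,\ell)}^t+g_\ell(\mathbf u),\qquad \mathbf v_{(i,\ell)}^t=\mathbf x_{(i,\ell)}^t+\gamma^t(\tilde{\mathbf x}_{(i,\ell)}^t-\mathbf x_{(i,\ell)}^t),$$ and $\mathbf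 v_{(i,\ell)}^t=\mathbf x_{(i,\ell)}^t$ for $\ell\ne\ell_i^t$; then, for all $\ell$, $$\phi_{(i,\ell)}^{t+1}=\sum_{j\in\mathcal N_i}a_{ij\ell}^t\phi_{(j,\ell)}^t,\qquad \mathbf x_{(i,\ell)}^{t+1}=\frac1{\phi_{(i,\ell)}^{t+1}}\sum_{j\in\mathcal N_i}a_{ij\ell}^t\phi_{(j,\ell)}^t\mathbf v_{(j,\ell)}^t,$$ $$\mathbf y_{(i,\ell)}^{t+1}=\frac1{\phi_{(i,\ell)}^{t+1}}\Big(\sum_{j\in\mathcal N_i}a_{ij\ell}^t\phi_{(j,\ell)}^t\mathbf y_{(j,\ell)}^t+\nabla_\ell f_i(\mathbf x_{(i)}^{t+1})-\nabla_\ell f_i(\mathbf x_{(i)}^t)\Big),\qquad \tilde{\boldsymbol\pi}_{(i,\ell)}^{t+1}=N\mathbf y_{(i,\ell)}^{t+1}-\nabla_\ell f_i(\mathbf x_{(i)}^{t+1}).$$ Let $\bar{\mathbf z}^t$ be the vector with blocks $\bar{\mathbf z}_\ell^t=\frac1N\sum_{i=1}^N\phi_{(i,\ell)}^t\mathbf x_{(i,\ell)}^t$.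 Then: (i) $\{\bar{\mathbf z}^t\}$ is bounded, and every limit point $\mathbf x^*$ of it is a stationary solution of (P), that is, $\mathbf x^*\in\mathcal K$ and there are subgradients $\boldsymbol\xi_\ell\in\partial g_\ell(\mathbf x^*_\ell)$ such that, with $\boldsymbol\xi=(\boldsymbol\xi_1,\dots,\boldsymbol\xi_B)$, $\big(\sum_{i=1}^N\nabla f_i(\mathbf x^*)+\boldsymbol\xi\big)^\top(\mathbf y-\mathbf x^*)\ge0$ for all $\mathbf y\in\mathcal K$; (ii) $\|\mathbf x_{(i)}^t-\bar{\mathbf z}^t\|\to0$ as $t\to\infty$, for every $i\in\{1,\dots,N\}$. -/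

import Mathlib

open scoped Topology InnerProductSpace

noncomputable section

namespace BlockSonata

/-- The space `ℝ^d` of a single block, with the Euclidean norm. -/
abbrev Blk (d : ℕ) : Type := EuclideanSpace ℝ (Fin d)

/-- The space `ℝ^{dB}` of the full variable `x = (x_1, …, x_B)`, with the Euclidean norm. The
`ℓ`-th block of `x` is `x ℓ`. -/
abbrev Var (B d : ℕ) : Type := PiLp 2 (fun _ : Fin B => Blk d)

/-- `ξ` is a subgradient at `x` of the function `g`, regarded as a function on `Ω`. -/
def IsSubgradientOn {d : ℕ} (Ω : Set (Blk d)) (g : Blk d → ℝ) (x ξ : Blk d) : Prop :=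
  ∀ y ∈ Ω, g x + ⟪ξ, y - x⟫_ℝ ≤ g y

/-- The data of the problem: minimize `∑ i, f i x + ∑ ℓ, g ℓ (x ℓ)` subject to `x ℓ ∈ K ℓ`.
`Ω ℓ` is the open set containing `K ℓ` on which `g ℓ` is convex (the whole space if `g ℓ` is
convex everywhere); the values of `g ℓ` outside `Ω ℓ` are irrelevant. -/
structure Problem (N B d : ℕ) where
  f : Fin N → Var B d → ℝ
  g : Fin B → Blk d → ℝ
  K : Fin B → Set (Blk d)
  Ω : Fin B → Set (Blk d)

namespace Problem

variable {N B d : ℕ} (P : Problem N B d)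

/-- The feasible set `K_1 × ⋯ × K_B`. -/
def feasible : Set (Var B d) := {x | ∀ ℓ, x ℓ ∈ P.K ℓ}

/-- The objective function `U`. -/
def U (x : Var B d) : ℝ := ∑ i, P.f i x + ∑ ℓ, P.g ℓ (x ℓ)

/-- Assumptions on the optimization problem. -/
structure Assumptions : Prop where
  nonempty : ∀ ℓ, (P.K ℓ).Nonempty
  closed : ∀ ℓ, IsClosed (P.K ℓ)
  convex : ∀ ℓ, Convex ℝ (P.K ℓ)
  f_contDiff : ∀ i, ∃ O : Set (Var B d), IsOpen O ∧ P.feasible ⊆ O ∧ ContDiffOn ℝ 1 (P.f i) O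
  grad_lipschitz : ∀ i, ∃ L : NNReal, LipschitzOnWith L (gradient (P.f i)) P.feasible
  grad_bounded : ∀ i, ∃ C : ℝ, ∀ x ∈ P.feasible, ‖gradient (P.f i) x‖ ≤ C
  g_open : ∀ ℓ, IsOpen (P.Ω ℓ)
  g_subset : ∀ ℓ, P.K ℓ ⊆ P.Ω ℓ
  g_convex : ∀ ℓ, ConvexOn ℝ (P.Ω ℓ) (P.g ℓ)
  subgrad_bounded : ∀ ℓ, ∃ C : ℝ, ∀ x ∈ P.K ℓ, ∀ ξ : Blk d,
    IsSubgradientOn (P.Ω ℓ) (P.g ℓ) x ξ → ‖ξ‖ ≤ C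
  coercive : Filter.Tendsto P.U (Bornology.cobounded (Var B d) ⊓ Filter.principal P.feasible)
    Filter.atTop

/-- `x` is a stationary solution: it is feasible and, for some subgradient `ξ` of
`x ↦ ∑ ℓ, g ℓ (x ℓ)` at `x`, `⟪∑ i, ∇ f i x + ξ, y - x⟫ ≥ 0` for every feasible `y`. -/
def IsStationary (x : Var B d) : Prop :=
  x ∈ P.feasible ∧ ∃ ξ : Var B d, (∀ ℓ, IsSubgradientOn (P.Ω ℓ) (P.g ℓ) (x ℓ) (ξ ℓ)) ∧
    ∀ y ∈ P.feasible, 0 ≤ ⟪∑ i, gradient (P.f i) x + ξ, y - x⟫_ℝ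

/-- Assumptions on the surrogate functions `ft i ℓ : K ℓ × K → ℝ` (values elsewhere are
irrelevant). `D u x` is the partial gradient of `ft i ℓ` in its first argument at `(u, x)`. -/
structure SurrogateAssumptions (ft : Fin N → Fin B → Blk d → Var B d → ℝ) : Prop where
  strongConvex : ∀ i, ∃ τ : ℝ, 0 < τ ∧ ∀ ℓ, ∀ x ∈ P.feasible,
    StrongConvexOn (P.K ℓ) τ (fun u => ft i ℓ u x)
  grad : ∀ i ℓ, ∃ D : Blk d → Var B d → Blk d,
    (∀ x ∈ P.feasible, ∀ u ∈ P.K ℓ,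
      HasGradientWithinAt (fun w => ft i ℓ w x) (D u x) (P.K ℓ) u) ∧
    (∀ x ∈ P.feasible, D (x ℓ) x = gradient (P.f i) x ℓ) ∧
    ∃ L : NNReal, ∀ u ∈ P.K ℓ, LipschitzOnWith L (D u) P.feasible

end Problem

/-- A directed graph is strongly connected: there is a directed path between any two nodes. -/
def StronglyConnected {V : Type*} (G : Digraph V) : Prop :=
  ∀ i j, Relation.ReflTransGen G.Adj i j

open Classical in
/-- The in-neighbors of `i`, including `i` itself. -/
def inNbr {N : ℕ} (G : Digraph (Fin N)) (i : Fin N) : Finset (Fin N) :=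
  Finset.univ.filter (fun j => G.Adj j i ∨ j = i)

/-- The in-neighbors of `i` that send block `ℓ`, together with `i`; `s j` is the block that agent
`j` sends. -/
def blockNbr {N B : ℕ} (G : Digraph (Fin N)) (s : Fin N → Fin B) (ℓ : Fin B) (i : Fin N) :
    Finset (Fin N) :=
  (inNbr G i).filter (fun j => s j = ℓ) ∪ {i}

/-- The weight matrices `A t ℓ` match the graphs of the blocks, and their nonzero entries lie in
`[θ, 1]` for a common `θ ∈ (0, 1)`. -/
def WeightsMatch {N B : ℕ} (G : Digraph (Fin N)) (blk : ℕ → Fin N → Fin B)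
    (A : ℕ → Fin B → Matrix (Fin N) (Fin N) ℝ) : Prop :=
  ∃ θ ∈ Set.Ioo (0 : ℝ) 1, ∀ t ℓ i j,
    (j ∈ blockNbr G (blk t) ℓ i → A t ℓ i j ∈ Set.Icc θ 1) ∧
    (j ∉ blockNbr G (blk t) ℓ i → A t ℓ i j = 0)

/-- All weight matrices are column stochastic. -/
def ColumnStochastic {N B : ℕ} (A : ℕ → Fin B → Matrix (Fin N) (Fin N) ℝ) : Prop :=
  ∀ t ℓ j, ∑ i, A t ℓ i j = 1

/-- Essentially cyclic block updating rule: every agent selects all the blocks in each window of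
`T` consecutive iterations, where `T` may depend on the agent. -/
def EssentiallyCyclic {N B : ℕ} (blk : ℕ → Fin N → Fin B) : Prop :=
  ∀ i, ∃ T : ℕ, 0 < T ∧ ∀ t, (⋃ s ∈ Finset.range T, {blk (t + s) i}) = (Set.univ : Set (Fin B))

/-- Assumptions on the step-size. -/
structure StepSize (γ : ℕ → ℝ) : Prop where
  pos : ∀ t, 0 < γ t
  le_one : ∀ t, γ t ≤ 1
  decay : ∃ η ∈ Set.Ioo (0 : ℝ) 1, ∀ t, η * γ t ≤ γ (t + 1) ∧ γ (t + 1) ≤ γ t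
  sum_eq_top : Filter.Tendsto (fun n => ∑ t ∈ Finset.range n, γ t) Filter.atTop Filter.atTop
  sum_sq : Summable (fun t => γ t ^ 2)

/-- The sequences of a run of the algorithm, for all iterations `t` and agents `i`:
`x t i`, `v t i`, `φ t i`, `y t i`, `π t i`, and the minimizer `xt t i` over the selected block. -/
structure Run (N B d : ℕ) where
  x : ℕ → Fin N → Var B d
  xt : ℕ → Fin N → Blk d
  v : ℕ → Fin N → Var B d
  φ : ℕ → Fin N → Fin B → ℝ
  y : ℕ → Fin N → Var B d
  π : ℕ → Fin N → Var B d

namespace Run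

variable {N B d : ℕ}

/-- The run `R` is generated by the algorithm with surrogates `ft`, graph `G`, selected blocks
`blk t i`, weights `A` and step-sizes `γ`. The initial points are arbitrary feasible points, and
the initial estimates `π 0 i` are arbitrary. -/
structure IsGenerated (R : Run N B d) (P : Problem N B d)
    (ft : Fin N → Fin B → Blk d → Var B d → ℝ) (G : Digraph (Fin N))
    (blk : ℕ → Fin N → Fin B) (A : ℕ → Fin B → Matrix (Fin N) (Fin N) ℝ) (γ : ℕ → ℝ) : Prop where
  x_zero : ∀ i, R.x 0 i ∈ P.feasible
  φ_zero : ∀ i ℓ, R.φ 0 i ℓ = 1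
  y_zero : ∀ i, R.y 0 i = gradient (P.f i) (R.x 0 i)
  xt_mem : ∀ t i, R.xt t i ∈ P.K (blk t i)
  xt_min : ∀ t i, IsMinOn
    (fun u => ft i (blk t i) u (R.x t i)
      + ⟪u - R.x t i (blk t i), R.π t i (blk t i)⟫_ℝ + P.g (blk t i) u)
    (P.K (blk t i)) (R.xt t i)
  v_selected : ∀ t i,
    R.v t i (blk t i) = R.x t i (blk t i) + γ t • (R.xt t i - R.x t i (blk t i))
  v_other : ∀ t i ℓ, ℓ ≠ blk t i → R.v t i ℓ = R.x t i ℓ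
  φ_succ : ∀ t i ℓ, R.φ (t + 1) i ℓ = ∑ j ∈ inNbr G i, A t ℓ i j * R.φ t j ℓ
  x_succ : ∀ t i ℓ, R.x (t + 1) i ℓ =
    (R.φ (t + 1) i ℓ)⁻¹ • ∑ j ∈ inNbr G i, (A t ℓ i j * R.φ t j ℓ) • R.v t j ℓ
  y_succ : ∀ t i ℓ, R.y (t + 1) i ℓ =
    (R.φ (t + 1) i ℓ)⁻¹ • (∑ j ∈ inNbr G i, (A t ℓ i j * R.φ t j ℓ) • R.y t j ℓ
      + gradient (P.f i) (R.x (t + 1) i) ℓ - gradient (P.f i) (R.x t i) ℓ)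
  π_succ : ∀ t i ℓ, R.π (t + 1) i ℓ =
    (N : ℝ) • R.y (t + 1) i ℓ - gradient (P.f i) (R.x (t + 1) i) ℓ

/-- The weighted average `(1/N) ∑ i, φ_(i) x_(i)`, where `φ_(i)` scales the `ℓ`-th block
by `φ_(i,ℓ)`. -/
def zbar (R : Run N B d) (t : ℕ) : Var B d :=
  WithLp.toLp 2 (fun ℓ => (1 / (N : ℝ)) • ∑ i, R.φ t i ℓ • R.x t i ℓ)

end Run

end BlockSonata

end

open scoped Topology InnerProductSpace

noncomputable section

namespace BlockSonata

/-! ### Square-summable real sequences -/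

/-! The algorithm is a perturbed averaging scheme coupled with a descent method, and every error is
controlled in `ℓ²`.

Consensus. For each block, self-loops, recurrence of every edge and strong connectivity make the
product of the weight matrices over a long enough window entrywise bounded below. Hence the `φ` stay
bounded below (`JointlyPositive.exists_lower_bound`), and the normalized weights `a_ij φ_j / φ_i⁺`
are row stochastic and contract the diameter of a family over a window
(`JointlyPositive.exists_contraction`). Bounded gradients bound the `y`, hence the directions `x̃ -
x`. Mixing is then perturbed by `O(γ)`, so the disagreement is square-summable, and so in turn are
the increments of the `x`, the disagreement of the `y` and the gradient tracking error
(`summable_sq_tracking`). This already gives (ii).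

Descent. Mixing preserves `φ`-weighted averages, so `zbar` moves only along the directions. Strong
convexity of the surrogates makes the Lyapunov function lose a multiple of `γ ‖x̃ - x‖²`, up to `γ`
times the tracking error and `γ²`, both summable (`exists_lyapunov_descent`). Coercivity then bounds
`zbar`, and `∑ γ ‖x̃ - x‖²` converges (`lyapunov_bounds`).

Stationarity. For one fixed agent and each block, let `m(z)` be the distance from `z ℓ` to the exact
best response at `z`, a Lipschitz function. Since the agent selects the block in each window, `∑ γ
m(zbar)²` converges; since `m(zbar)` moves by `O(γ)` and `∑ γ` diverges, `m(zbar) → 0` along the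
whole sequence (`tendsto_zero_of_slowly_varying`). At a limit point `m` vanishes, which is a
variational inequality in each block, and separation of convex sets turns it into one with a
subgradient (`exists_isSubgradientOn_inner_nonneg`). -/

theorem summable_sq_of_le {a b : ℕ → ℝ} (hb : Summable fun t => b t ^ 2)
    (h : ∀ t, |a t| ≤ b t) : Summable fun t => a t ^ 2 := by
  refine hb.of_nonneg_of_le (fun t => sq_nonneg _) fun t => ?_
  rw [← sq_abs]
  exact pow_le_pow_left₀ (abs_nonneg _) (h t) 2

theorem summable_sq_const_mul {a : ℕ → ℝ} (ha : Summable fun t => a t ^ 2) (c : ℝ) :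
    Summable fun t => (c * a t) ^ 2 := by
  simp only [mul_pow]
  exact ha.mul_left _

theorem summable_sq_add {a b : ℕ → ℝ} (ha : Summable fun t => a t ^ 2)
    (hb : Summable fun t => b t ^ 2) : Summable fun t => (a t + b t) ^ 2 := by
  refine ((ha.add hb).mul_left 2).of_nonneg_of_le (fun t => sq_nonneg _) fun t => ?_
  nlinarith [sq_nonneg (a t - b t)]

theorem summable_sq_sum {ι : Type*} (s : Finset ι) {a : ι → ℕ → ℝ}
    (ha : ∀ i ∈ s, Summable fun t => a i t ^ 2) :
    Summable fun t => (∑ i ∈ s, a i t) ^ 2 := by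
  classical
  induction s using Finset.induction_on with
  | empty => simp
  | insert i s his ih =>
    simp only [Finset.sum_insert his]
    exact summable_sq_add (ha i (Finset.mem_insert_self i s))
      (ih fun j hj => ha j (Finset.mem_insert_of_mem hj))

theorem summable_sq_shift {a : ℕ → ℝ} (ha : Summable fun t => a t ^ 2) (k : ℕ) :
    Summable fun t => a (t + k) ^ 2 :=
  (summable_nat_add_iff (f := fun t => a t ^ 2) k).2 ha

theorem summable_mul_of_sq {a b : ℕ → ℝ} (ha : Summable fun t => a t ^ 2)
    (hb : Summable fun t => b t ^ 2) : Summable fun t => a t * b t := by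
  refine Summable.of_norm_bounded (ha.add hb) fun t => ?_
  rw [Real.norm_eq_abs, abs_mul]
  nlinarith [sq_nonneg (|a t| - |b t|), sq_abs (a t), sq_abs (b t),
    mul_nonneg (abs_nonneg (a t)) (abs_nonneg (b t))]

theorem tendsto_zero_of_summable_sq {a : ℕ → ℝ} (ha : Summable fun t => a t ^ 2) :
    Filter.Tendsto a Filter.atTop (𝓝 0) := by
  have h := ha.tendsto_atTop_zero.sqrt
  simp only [Real.sqrt_sq_eq_abs, Real.sqrt_zero] at h
  exact (tendsto_zero_iff_abs_tendsto_zero _).2 h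

/-! ### Recursive inequalities -/

/-- The squares obey a linear recursion with the same factor `q`; summed over `t`, the partial sum
bounds itself with factor `q < 1`. -/
theorem summable_sq_of_contraction {a b : ℕ → ℝ} (ha : ∀ t, 0 ≤ a t) {q : ℝ} (hq0 : 0 ≤ q)
    (hq : q < 1) (M : ℕ) (h : ∀ t, a (t + M) ≤ q * a t + b t)
    (hb : Summable fun t => b t ^ 2) : Summable fun t => a t ^ 2 := by
  have hq' : 0 < 1 - q := by linarith
  have key : ∀ t, a (t + M) ^ 2 ≤ q * a t ^ 2 + (1 - q)⁻¹ * b t ^ 2 := by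
    intro t
    have h1 : a (t + M) ^ 2 ≤ (q * a t + b t) ^ 2 := pow_le_pow_left₀ (ha _) (h t) 2
    -- With `b = (1 - q) c` the claim is convexity of the square with weights `q` and `1 - q`.
    obtain ⟨c, hc⟩ : ∃ c, b t = (1 - q) * c := ⟨(1 - q)⁻¹ * b t, by field_simp⟩
    have h2 : (1 - q)⁻¹ * b t ^ 2 = (1 - q) * c ^ 2 := by rw [hc]; field_simp
    rw [h2]
    rw [hc] at h1
    nlinarith [mul_nonneg (mul_nonneg hq0 hq'.le) (sq_nonneg (a t - c))]
  refine summable_of_sum_range_le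
    (c := (1 - q)⁻¹ * (∑ t ∈ Finset.range M, a t ^ 2 + (1 - q)⁻¹ * ∑' t, b t ^ 2))
    (fun t => sq_nonneg _) fun n => ?_
  have h1 : ∑ t ∈ Finset.range n, a t ^ 2 ≤ ∑ t ∈ Finset.range (M + n), a t ^ 2 :=
    Finset.sum_le_sum_of_subset_of_nonneg
      (Finset.range_mono (Nat.le_add_left _ _)) fun _ _ _ => sq_nonneg _
  rw [Finset.sum_range_add] at h1
  have h2 : ∑ t ∈ Finset.range n, a (M + t) ^ 2
      ≤ q * ∑ t ∈ Finset.range n, a t ^ 2 + (1 - q)⁻¹ * ∑ t ∈ Finset.range n, b t ^ 2 := by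
    rw [Finset.mul_sum, Finset.mul_sum, ← Finset.sum_add_distrib]
    refine Finset.sum_le_sum fun t _ => ?_
    rw [add_comm M t]
    exact key t
  have h3 : ∑ t ∈ Finset.range n, b t ^ 2 ≤ ∑' t, b t ^ 2 :=
    hb.sum_le_tsum _ fun _ _ => sq_nonneg _
  have h4 := mul_le_mul_of_nonneg_left h3 (inv_pos.2 hq').le
  rw [← div_eq_inv_mul _ (1 - q), le_div_iff₀ hq']
  nlinarith

/-- The fixed point `b / (1 - q)` of `s ↦ q s + b` bounds the recursion; the sum of the first `M`
terms covers the initial values. -/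
theorem bounded_of_contraction {a : ℕ → ℝ} {b q : ℝ} (ha : ∀ t, 0 ≤ a t) (hq0 : 0 ≤ q)
    (hq : q < 1) {M : ℕ} (hM : 0 < M) (h : ∀ t, a (t + M) ≤ q * a t + b) (hb : 0 ≤ b) :
    ∃ C, ∀ t, a t ≤ C := by
  have hq' : 0 < 1 - q := by linarith
  have hs : 0 ≤ ∑ s ∈ Finset.range M, a s := Finset.sum_nonneg fun s _ => ha s
  have hd : (1 - q) * (b / (1 - q)) = b := by field_simp
  have hd0 : 0 ≤ b / (1 - q) := by positivity
  refine ⟨∑ s ∈ Finset.range M, a s + b / (1 - q), fun t => ?_⟩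
  induction t using Nat.strong_induction_on with
  | _ t ih =>
    by_cases ht : t < M
    · have := Finset.single_le_sum (f := a) (fun s _ => ha s) (Finset.mem_range.2 ht)
      linarith
    · have h1 := h (t - M)
      rw [Nat.sub_add_cancel (not_lt.1 ht)] at h1
      have h2 := mul_le_mul_of_nonneg_left (ih (t - M) (by omega)) hq0
      nlinarith

/-- A nonnegative sequence that is slowly varying and small on average with respect to step-sizes
of divergent sum tends to zero. -/
theorem tendsto_zero_of_slowly_varying {m γ : ℕ → ℝ} {C : ℝ} (hm : ∀ t, 0 ≤ m t)
    (hγ0 : ∀ t, 0 ≤ γ t) (hγ1 : ∀ t, γ t ≤ 1) (hγ2 : Summable fun t => γ t ^ 2)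
    (hγ : Filter.Tendsto (fun n => ∑ t ∈ Finset.range n, γ t) Filter.atTop Filter.atTop)
    (hvar : ∀ t, |m (t + 1) - m t| ≤ C * γ t) (hsum : Summable fun t => γ t * m t ^ 2) :
    Filter.Tendsto m Filter.atTop (𝓝 0) := by
  -- The increments of `m ^ 3` are bounded by multiples of `γ m²` and `γ²`, both summable, so the
  -- cube converges.
  have hcauchy : CauchySeq fun t => m t ^ 3 := by
    refine cauchySeq_of_summable_dist ?_
    refine ((hsum.mul_left (5 * |C|)).add
      (hγ2.mul_left (3 * |C| * C ^ 2))).of_nonneg_of_le (fun t => dist_nonneg) fun t => ?_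
    have h1 : |m (t + 1) - m t| ≤ |C| * γ t :=
      (hvar t).trans (mul_le_mul_of_nonneg_right (le_abs_self C) (hγ0 t))
    obtain ⟨e, he⟩ : ∃ e, m (t + 1) = m t + e := ⟨m (t + 1) - m t, by ring⟩
    rw [he, add_sub_cancel_left] at h1
    have he2 : e ^ 2 ≤ C ^ 2 * γ t := by
      have : e ^ 2 ≤ (|C| * γ t) ^ 2 := by
        rw [← sq_abs e]; exact pow_le_pow_left₀ (abs_nonneg _) h1 2
      rw [mul_pow, sq_abs] at this
      nlinarith [mul_nonneg (sq_nonneg C)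
        (mul_nonneg (hγ0 t) (sub_nonneg.2 (hγ1 t)))]
    rw [dist_comm, Real.dist_eq, he]
    have h3 : (m t + e) ^ 3 - m t ^ 3 = e * (3 * m t ^ 2 + 3 * m t * e + e ^ 2) := by ring
    have h4 : 0 ≤ 3 * m t ^ 2 + 3 * m t * e + e ^ 2 := by
      nlinarith [sq_nonneg (3 * m t + 2 * e), sq_nonneg (m t)]
    rw [h3, abs_mul, abs_of_nonneg h4]
    have h5 : 3 * m t ^ 2 + 3 * m t * e + e ^ 2 ≤ 5 * m t ^ 2 + 3 * (C ^ 2 * γ t) := by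
      nlinarith [sq_nonneg (3 * m t - 4 * e), sq_nonneg (m t), sq_nonneg (e)]
    calc |e| * (3 * m t ^ 2 + 3 * m t * e + e ^ 2)
        ≤ (|C| * γ t) * (5 * m t ^ 2 + 3 * (C ^ 2 * γ t)) :=
          mul_le_mul h1 h5 h4 (mul_nonneg (abs_nonneg C) (hγ0 t))
      _ = _ := by ring
  obtain ⟨L, hL⟩ := cauchySeq_tendsto_of_complete hcauchy
  have hL0 : 0 ≤ L := ge_of_tendsto' hL fun t => pow_nonneg (hm t) 3
  have hroot : Filter.Tendsto m Filter.atTop (𝓝 (L ^ (3 : ℝ)⁻¹)) := by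
    have := hL.rpow_const (p := (3 : ℝ)⁻¹) (Or.inr (by norm_num))
    refine this.congr fun t => ?_
    have := Real.pow_rpow_inv_natCast (hm t) (n := 3) (by norm_num)
    simpa using this
  set r := L ^ (3 : ℝ)⁻¹
  have hr : 0 ≤ r := Real.rpow_nonneg hL0 _
  rcases hr.eq_or_lt with hr | hr
  · rwa [← hr] at hroot
  exfalso
  have hev : ∀ᶠ t in Filter.atTop, r / 2 ≤ m t :=
    (hroot.eventually (eventually_gt_nhds (show r / 2 < r by linarith))).mono fun t h => h.le
  -- A positive limit would make `γ` eventually at most a constant times `γ m²`, hence summable.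
  have hγs : Summable γ := by
    refine summable_of_isBigO_nat hsum ?_
    refine Asymptotics.IsBigO.of_bound ((r / 2) ^ 2)⁻¹ ?_
    filter_upwards [hev] with t ht
    rw [Real.norm_of_nonneg (hγ0 t),
      Real.norm_of_nonneg (mul_nonneg (hγ0 t) (sq_nonneg _)), ← div_eq_inv_mul,
      le_div_iff₀ (by positivity)]
    exact mul_le_mul_of_nonneg_left (pow_le_pow_left₀ (by positivity) ht 2) (hγ0 t)
  exact not_tendsto_atTop_of_tendsto_nhds hγs.hasSum.tendsto_sum_nat hγ

theorem le_of_perturbed_descent {a b c : ℕ → ℝ} (hc0 : ∀ t, 0 ≤ c t) (hc : Summable c) (h : ∀ t, a (t + 1) ≤ a t - b t + c t) (n : ℕ) :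
    a n + ∑ t ∈ Finset.range n, b t ≤ a 0 + ∑' t, c t := by
  have h1 : a n + ∑ t ∈ Finset.range n, b t ≤ a 0 + ∑ t ∈ Finset.range n, c t := by
    induction n with
    | zero => simp
    | succ n ih =>
      rw [Finset.sum_range_succ, Finset.sum_range_succ]
      linarith [h n]
  linarith [hc.sum_le_tsum (Finset.range n) fun t _ => hc0 t]

/-- Pointwise bounds on a finite family of sequences can be made uniform. -/
theorem exists_uniform_bound {ι α : Type*} [Finite ι] {p : ι → α → ℝ}
    (h : ∀ i, ∃ C, ∀ a, p i a ≤ C) : ∃ C, 0 < C ∧ ∀ i a, p i a ≤ C := by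
  choose C hC using h
  obtain ⟨D, hD⟩ := (Set.finite_range C).bddAbove
  exact ⟨max D 1, by positivity, fun i a =>
    (hC i a).trans ((hD (Set.mem_range_self i)).trans (le_max_left _ _))⟩

/-! ### Products of nonnegative matrices and perturbed consensus -/

section WeightedSums

variable {ι E : Type*} [Fintype ι] [NormedAddCommGroup E]

theorem norm_sub_le_diam (u : ι → E) (i j : ι) :
    ‖u i - u j‖ ≤ Metric.diam (Set.range u) := by
  rw [← dist_eq_norm]
  exact Metric.dist_le_diam_of_mem (Set.finite_range u).isBounded ⟨i, rfl⟩ ⟨j, rfl⟩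

/-- Two weighted sums with the same total weight `w` of a family differ by at most `w` times its
diameter. -/
theorem norm_sum_smul_sub_sum_smul_le [NormedSpace ℝ E] (u : ι → E) {a b : ι → ℝ} {w : ℝ} (ha : ∀ i, 0 ≤ a i)
    (hb : ∀ i, 0 ≤ b i) (hw : 0 ≤ w) (hsa : ∑ i, a i = w) (hsb : ∑ i, b i = w) :
    ‖∑ i, a i • u i - ∑ i, b i • u i‖ ≤ w * Metric.diam (Set.range u) := by
  rcases hw.eq_or_lt with hw | hw
  · have ha0 := (Finset.sum_eq_zero_iff_of_nonneg fun i _ => ha i).1 (hsa.trans hw.symm)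
    have hb0 := (Finset.sum_eq_zero_iff_of_nonneg fun i _ => hb i).1 (hsb.trans hw.symm)
    have ha1 : ∑ i, a i • u i = 0 :=
      Finset.sum_eq_zero fun i hi => by rw [ha0 i hi, zero_smul]
    have hb1 : ∑ i, b i • u i = 0 :=
      Finset.sum_eq_zero fun i hi => by rw [hb0 i hi, zero_smul]
    simp [ha1, hb1, ← hw]
  -- Multiplication by `w` couples the two weightings: each term becomes a difference `u i - u j`
  -- with weight `a i * b j`.
  · have h1 : w • (∑ i, a i • u i - ∑ i, b i • u i)
        = ∑ i, ∑ j, (a i * b j) • (u i - u j) := by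
      simp only [smul_sub, Finset.sum_sub_distrib]
      congr 1
      · simp only [← Finset.sum_smul, ← Finset.mul_sum, hsb, Finset.smul_sum, smul_smul, mul_comm]
      · rw [Finset.sum_comm]
        simp only [← Finset.sum_smul, ← Finset.sum_mul, hsa, Finset.smul_sum, smul_smul]
    have h2 : ‖w • (∑ i, a i • u i - ∑ i, b i • u i)‖
        ≤ ∑ i, ∑ j, (a i * b j) * Metric.diam (Set.range u) := by
      rw [h1]
      refine norm_sum_le_of_le _ fun i _ => norm_sum_le_of_le _ fun j _ => ?_
      rw [norm_smul, Real.norm_of_nonneg (mul_nonneg (ha i) (hb j))]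
      exact mul_le_mul_of_nonneg_left (norm_sub_le_diam u i j) (mul_nonneg (ha i) (hb j))
    simp only [← Finset.sum_mul, ← Finset.mul_sum, hsa, hsb] at h2
    rw [norm_smul, Real.norm_of_nonneg hw.le, mul_assoc] at h2
    exact le_of_mul_le_mul_left h2 hw

/-- Subtracting the common part `δ` from all entries does not change the difference and leaves a
total weight of only `1 - card ι * δ`. -/
theorem diam_sum_smul_le [NormedSpace ℝ E] {V : Matrix ι ι ℝ} {δ : ℝ} (hV : ∀ i j, δ ≤ V i j)
    (hrow : ∀ i, ∑ j, V i j = 1) (u : ι → E) (i i' : ι) :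
    ‖∑ j, V i j • u j - ∑ j, V i' j • u j‖
      ≤ (1 - Fintype.card ι * δ) * Metric.diam (Set.range u) := by
  have hs : ∀ i, ∑ j, (V i j - δ) = 1 - Fintype.card ι * δ := fun i => by
    simp [Finset.sum_sub_distrib, hrow]
  have h := norm_sum_smul_sub_sum_smul_le u (a := fun j => V i j - δ) (b := fun j => V i' j - δ)
    (fun j => sub_nonneg.2 (hV i j)) (fun j => sub_nonneg.2 (hV i' j))
    (by rw [← hs i]; exact Finset.sum_nonneg fun j _ => sub_nonneg.2 (hV i j)) (hs i) (hs i')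
  simpa [sub_smul, Finset.sum_sub_distrib] using h

end WeightedSums

section Consensus

variable {ι : Type*} [Fintype ι] [DecidableEq ι]

/-- The product `W (t + k - 1) * ⋯ * W t`. -/
def transition (W : ℕ → Matrix ι ι ℝ) (t : ℕ) : ℕ → Matrix ι ι ℝ
  | 0 => 1
  | k + 1 => W (t + k) * transition W t k

/-- Nonnegative matrices whose diagonal entries are at least `κ` and whose entries on the edges of
`r` are at least `κ` once in each window of `T` steps. -/
structure JointlyPositive (r : ι → ι → Prop) (W : ℕ → Matrix ι ι ℝ) (κ : ℝ) (T : ℕ) : Prop where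
  pos : 0 < κ
  nonneg : ∀ t i j, 0 ≤ W t i j
  diag : ∀ t i, κ ≤ W t i i
  edge : ∀ t i j, r j i → ∃ s < T, κ ≤ W (t + s) i j

/-- Row stochastic matrices. -/
def RowStochastic (W : ℕ → Matrix ι ι ℝ) : Prop := ∀ t i, ∑ j, W t i j = 1

variable {r : ι → ι → Prop} {W : ℕ → Matrix ι ι ℝ} {κ : ℝ} {T : ℕ}

theorem transition_nonneg (hW : ∀ t i j, 0 ≤ W t i j) (t k : ℕ) (i j : ι) :
    0 ≤ transition W t k i j := by
  induction k generalizing i with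
  | zero =>
    rw [transition, Matrix.one_apply]
    split_ifs <;> norm_num
  | succ k ih =>
    rw [transition, Matrix.mul_apply]
    exact Finset.sum_nonneg fun b _ => mul_nonneg (hW _ _ _) (ih b)

theorem transition_rowSum (hW : RowStochastic W) (t k : ℕ) (i : ι) :
    ∑ j, transition W t k i j = 1 := by
  induction k generalizing i with
  | zero => simp [transition, Matrix.one_apply]
  | succ k ih =>
    simp only [transition, Matrix.mul_apply]
    rw [Finset.sum_comm]
    simp only [← Finset.mul_sum, ih, mul_one]
    exact hW _ i

theorem JointlyPositive.mul_le_transition_succ (h : JointlyPositive r W κ T) (t k : ℕ)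
    (i b j : ι) : W (t + k) i b * transition W t k b j ≤ transition W t (k + 1) i j := by
  rw [transition, Matrix.mul_apply]
  exact Finset.single_le_sum (f := fun b => W (t + k) i b * transition W t k b j)
    (fun b _ => mul_nonneg (h.nonneg _ _ _) (transition_nonneg h.nonneg _ _ _ _))
    (Finset.mem_univ b)

/-- A walk can wait at its endpoint: each self-loop costs one factor `κ`. -/
theorem JointlyPositive.pow_le_of_le (h : JointlyPositive r W κ T) {t k k' : ℕ} (hk : k ≤ k')
    {i j : ι} (hij : κ ^ k ≤ transition W t k i j) : κ ^ k' ≤ transition W t k' i j := by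
  induction k', hk using Nat.le_induction with
  | base => exact hij
  | succ n _ ih =>
    refine le_trans ?_ (h.mul_le_transition_succ t n i i j)
    rw [pow_succ']
    exact mul_le_mul (h.diag _ _) ih (pow_nonneg h.pos.le _) (h.nonneg _ _ _)

theorem JointlyPositive.pow_le_diag (h : JointlyPositive r W κ T) (t k : ℕ) (i : ι) :
    κ ^ k ≤ transition W t k i i :=
  h.pow_le_of_le (Nat.zero_le k) (by simp [transition])

theorem JointlyPositive.exists_pow_le_of_path (h : JointlyPositive r W κ T) {i j : ι}
    (hij : Relation.ReflTransGen r j i) :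
    ∃ n, ∀ t k, n ≤ k → κ ^ k ≤ transition W t k i j := by
  induction hij with
  | refl => exact ⟨0, fun t k _ => h.pow_le_diag t k j⟩
  | @tail b i _ hbi ih =>
    obtain ⟨n, hn⟩ := ih
    refine ⟨n + T, fun t k hk => ?_⟩
    -- The walk reaches `b` by time `t + n`, waits there until the edge to `i` opens, and then
    -- crosses it.
    obtain ⟨s, hs, hW⟩ := h.edge (t + n) i b hbi
    refine h.pow_le_of_le (k := n + s + 1) (by omega) ?_
    refine le_trans ?_ (h.mul_le_transition_succ t (n + s) i b j)
    rw [pow_succ', ← add_assoc]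
    exact mul_le_mul hW (hn t (n + s) (by omega)) (pow_nonneg h.pos.le _) (h.nonneg _ _ _)

theorem JointlyPositive.exists_pow_le (h : JointlyPositive r W κ T)
    (hr : ∀ i j, Relation.ReflTransGen r i j) :
    ∃ M, 0 < M ∧ ∀ t i j, κ ^ M ≤ transition W t M i j := by
  choose n hn using fun p : ι × ι => h.exists_pow_le_of_path (hr p.2 p.1)
  -- The path bounds hold for all larger lengths, so the sum over all pairs is a common length; `+
  -- 1` makes it positive.
  refine ⟨∑ p, n p + 1, Nat.succ_pos _, fun t i j => hn (i, j) t _ ?_⟩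
  exact (Finset.single_le_sum (fun p _ => Nat.zero_le (n p)) (Finset.mem_univ (i, j))).trans
    (Nat.le_succ _)

/-- Positivity of the weights generated by column stochastic matrices. -/
theorem JointlyPositive.exists_lower_bound [Nonempty ι] (h : JointlyPositive r W κ T) (hκ : κ ≤ 1)
    (hr : ∀ i j, Relation.ReflTransGen r i j) {φ : ℕ → ι → ℝ} (h0 : ∀ i, φ 0 i = 1)
    (hsucc : ∀ t i, φ (t + 1) i = ∑ j, W t i j * φ t j)
    (hcol : ∀ t j, ∑ i, W t i j = 1) :
    (∀ t, ∑ i, φ t i = Fintype.card ι) ∧ ∃ c, 0 < c ∧ ∀ t i, c ≤ φ t i := by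
  have hsum : ∀ t, ∑ i, φ t i = Fintype.card ι := by
    intro t
    induction t with
    | zero => simp [h0]
    | succ t ih =>
      simp only [hsucc]
      rw [Finset.sum_comm]
      simp only [← Finset.sum_mul, hcol, one_mul, ih]
  have hnn : ∀ t i, 0 ≤ φ t i := by
    intro t
    induction t with
    | zero => simp [h0]
    | succ t ih =>
      intro i
      rw [hsucc]
      exact Finset.sum_nonneg fun j _ => mul_nonneg (h.nonneg _ _ _) (ih j)
  have htr : ∀ t k i, φ (t + k) i = ∑ j, transition W t k i j * φ t j := by
    intro t k
    induction k with
    | zero => simp [transition, Matrix.one_apply]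
    | succ k ih =>
      intro i
      rw [← add_assoc, hsucc]
      simp only [ih, transition, Matrix.mul_apply, Finset.sum_mul, Finset.mul_sum]
      rw [Finset.sum_comm]
      simp only [mul_assoc]
  obtain ⟨M, -, hMp⟩ := h.exists_pow_le hr
  -- Up to time `M` the diagonal entry carries the initial value `1`; later, the last `M` steps give
  -- each node at least `κ ^ M` times the total mass, which is at least `1`.
  refine ⟨hsum, κ ^ M, pow_pos h.pos _, fun t i => ?_⟩
  by_cases ht : t ≤ M
  · have h1 : κ ^ t ≤ φ t i := by
      have h2 := htr 0 t i
      rw [zero_add] at h2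
      rw [h2]
      refine (h.pow_le_diag 0 t i).trans ?_
      have := Finset.single_le_sum (f := fun j => transition W 0 t i j * φ 0 j)
        (fun j _ => mul_nonneg (transition_nonneg h.nonneg _ _ _ _) (hnn _ _)) (Finset.mem_univ i)
      simpa [h0] using this
    exact (pow_le_pow_of_le_one h.pos.le hκ ht).trans h1
  · obtain ⟨s, rfl⟩ := Nat.exists_eq_add_of_le (not_le.1 ht).le
    rw [add_comm, htr]
    have h1 : ∑ j, κ ^ M * φ s j ≤ ∑ j, transition W s M i j * φ s j :=
      Finset.sum_le_sum fun j _ => mul_le_mul_of_nonneg_right (hMp _ _ _) (hnn _ _)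
    rw [← Finset.mul_sum, hsum] at h1
    have h2 : (1 : ℝ) ≤ Fintype.card ι := by exact_mod_cast Fintype.card_pos
    nlinarith [pow_pos h.pos M]

variable {E : Type*} [NormedAddCommGroup E] [NormedSpace ℝ E]

/-- Row stochastic averaging does not amplify errors, so the perturbations simply add up. -/
theorem norm_sub_transition_le (hW : ∀ t i j, 0 ≤ W t i j) (hrow : RowStochastic W)
    {u : ℕ → ι → E} {ε : ℕ → ℝ} (hu : ∀ t i, ‖u (t + 1) i - ∑ j, W t i j • u t j‖ ≤ ε t)
    (t k : ℕ) (i : ι) :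
    ‖u (t + k) i - ∑ j, transition W t k i j • u t j‖ ≤ ∑ s ∈ Finset.range k, ε (t + s) := by
  induction k generalizing i with
  | zero => simp [transition, Matrix.one_apply]
  | succ k ih =>
    have h1 : ∑ j, transition W t (k + 1) i j • u t j
        = ∑ b, W (t + k) i b • ∑ j, transition W t k b j • u t j := by
      simp only [transition, Matrix.mul_apply, Finset.sum_smul, Finset.smul_sum, smul_smul]
      rw [Finset.sum_comm]
    have h2 : u (t + (k + 1)) i - ∑ j, transition W t (k + 1) i j • u t j
        = (u (t + k + 1) i - ∑ b, W (t + k) i b • u (t + k) b)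
          + ∑ b, W (t + k) i b • (u (t + k) b - ∑ j, transition W t k b j • u t j) := by
      rw [h1]
      simp only [smul_sub, Finset.sum_sub_distrib, add_assoc]
      abel
    rw [h2, Finset.sum_range_succ, add_comm (∑ s ∈ Finset.range k, ε (t + s))]
    refine (norm_add_le _ _).trans (add_le_add (hu _ _) ?_)
    have h3 : ‖∑ b, W (t + k) i b • (u (t + k) b - ∑ j, transition W t k b j • u t j)‖
        ≤ ∑ b, W (t + k) i b * ∑ s ∈ Finset.range k, ε (t + s) := by
      refine norm_sum_le_of_le _ fun b _ => ?_
      rw [norm_smul, Real.norm_of_nonneg (hW _ _ _)]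
      exact mul_le_mul_of_nonneg_left (ih b) (hW _ _ _)
    rwa [← Finset.sum_mul, hrow, one_mul] at h3

/-- `M` and `q` depend only on the matrices, so the same contraction serves both the `x` and the
`y`. The factor `2` counts the perturbations accumulated at the two indices compared. -/
theorem JointlyPositive.exists_contraction [Nonempty ι] (h : JointlyPositive r W κ T)
    (hr : ∀ i j, Relation.ReflTransGen r i j) (hrow : RowStochastic W) :
    ∃ M q, 0 < M ∧ 0 ≤ q ∧ q < 1 ∧ ∀ (u : ℕ → ι → E) (ε : ℕ → ℝ),
      (∀ t i, ‖u (t + 1) i - ∑ j, W t i j • u t j‖ ≤ ε t) →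
      ∀ t, Metric.diam (Set.range (u (t + M))) ≤
        q * Metric.diam (Set.range (u t)) + 2 * ∑ s ∈ Finset.range M, ε (t + s) := by
  obtain ⟨M, hM, hMp⟩ := h.exists_pow_le hr
  have hc : (0 : ℝ) < Fintype.card ι := by exact_mod_cast Fintype.card_pos
  have hκ : 0 < κ ^ M := pow_pos h.pos M
  obtain ⟨i₀⟩ := ‹Nonempty ι›
  have hq : 0 ≤ 1 - Fintype.card ι * κ ^ M := by
    have := Finset.sum_le_sum fun j (_ : j ∈ Finset.univ) => hMp 0 i₀ j
    rw [transition_rowSum hrow] at this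
    simpa using this
  refine ⟨M, 1 - Fintype.card ι * κ ^ M, hM, hq, by nlinarith, fun u ε hu t => ?_⟩
  have hε : 0 ≤ ∑ s ∈ Finset.range M, ε (t + s) :=
    Finset.sum_nonneg fun s _ => (norm_nonneg _).trans (hu (t + s) i₀)
  refine Metric.diam_le_of_forall_dist_le
    (add_nonneg (mul_nonneg hq Metric.diam_nonneg) (by positivity)) ?_
  rintro _ ⟨i, rfl⟩ _ ⟨j, rfl⟩
  have h1 := norm_sub_transition_le h.nonneg hrow hu t M i
  have h2 := norm_sub_transition_le h.nonneg hrow hu t M j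
  have h3 := diam_sum_smul_le (hMp t) (transition_rowSum hrow t M) (u t) i j
  rw [dist_eq_norm]
  set a := ∑ b, transition W t M i b • u t b
  set b := ∑ b, transition W t M j b • u t b
  have h4 : u (t + M) i - u (t + M) j = (u (t + M) i - a) + (a - b) - (u (t + M) j - b) := by abel
  rw [h4]
  refine (norm_sub_le _ _).trans ?_
  linarith [norm_add_le (u (t + M) i - a) (a - b)]

theorem JointlyPositive.summable_sq_norm_sub [Nonempty ι] (h : JointlyPositive r W κ T)
    (hr : ∀ i j, Relation.ReflTransGen r i j) (hrow : RowStochastic W) {u : ℕ → ι → E}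
    {ε : ℕ → ℝ} (hu : ∀ t i, ‖u (t + 1) i - ∑ j, W t i j • u t j‖ ≤ ε t)
    (hε : Summable fun t => ε t ^ 2) (i j : ι) :
    Summable fun t => ‖u t i - u t j‖ ^ 2 := by
  obtain ⟨M, q, -, hq0, hq1, hc⟩ := h.exists_contraction (E := E) hr hrow
  refine summable_sq_of_le (b := fun t => Metric.diam (Set.range (u t))) ?_ fun t => ?_
  · refine summable_sq_of_contraction (fun t => Metric.diam_nonneg) hq0 hq1 M (hc u ε hu) ?_
    exact summable_sq_const_mul (summable_sq_sum _ fun s _ => summable_sq_shift hε s) 2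
  · rw [abs_of_nonneg (norm_nonneg _)]
    exact norm_sub_le_diam _ _ _

theorem JointlyPositive.bounded_norm_sub [Nonempty ι] (h : JointlyPositive r W κ T)
    (hr : ∀ i j, Relation.ReflTransGen r i j) (hrow : RowStochastic W) {u : ℕ → ι → E}
    {ε : ℝ} (hu : ∀ t i, ‖u (t + 1) i - ∑ j, W t i j • u t j‖ ≤ ε) :
    ∃ C, ∀ t i j, ‖u t i - u t j‖ ≤ C := by
  obtain ⟨M, q, hM, hq0, hq1, hc⟩ := h.exists_contraction (E := E) hr hrow
  obtain ⟨i₀⟩ := ‹Nonempty ι›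
  have hε : 0 ≤ ε := (norm_nonneg _).trans (hu 0 i₀)
  obtain ⟨C, hC⟩ := bounded_of_contraction (a := fun t => Metric.diam (Set.range (u t)))
    (b := 2 * (M * ε)) (fun t => Metric.diam_nonneg) hq0 hq1 hM (fun t => by simpa using hc u (fun _ => ε) hu t) (by positivity)
  exact ⟨C, fun t i j => (norm_sub_le_diam _ _ _).trans (hC t)⟩

end Consensus

/-! ### Convex analysis -/

section ConvexAnalysis

variable {E : Type*} [NormedAddCommGroup E] [InnerProductSpace ℝ E]

/-- A lower bound on the increments along a segment is a lower bound on the derivative. -/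
theorem le_fderivWithin_of_forall_le {f : E → ℝ} {f' : E →L[ℝ] ℝ} {K : Set E} (hK : Convex ℝ K)
    {x w : E} (hx : x ∈ K) (hw : w ∈ K) (hf : HasFDerivWithinAt f f' K x) {c : ℝ}
    (h : ∀ s ∈ Set.Ioc (0 : ℝ) 1, s * c ≤ f (x + s • (w - x)) - f x) : c ≤ f' (w - x) := by
  have hline : HasDerivWithinAt (fun s : ℝ => x + s • (w - x)) (w - x) (Set.Ioc 0 1) 0 := by
    simpa using ((hasDerivAt_id (0 : ℝ)).smul_const (w - x)).const_add x |>.hasDerivWithinAt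
  have hmaps : Set.MapsTo (fun s : ℝ => x + s • (w - x)) (Set.Ioc 0 1) K := fun s hs =>
    hK.add_smul_sub_mem hx hw ⟨hs.1.le, hs.2⟩
  have hd : HasDerivWithinAt (fun s : ℝ => f (x + s • (w - x))) (f' (w - x)) (Set.Ioc 0 1) 0 :=
    HasFDerivWithinAt.comp_hasDerivWithinAt_of_eq (0 : ℝ) hf hline hmaps (by simp)
  rw [hasDerivWithinAt_iff_tendsto_slope' (by simp)] at hd
  have : (𝓝[Set.Ioc (0 : ℝ) 1] 0).NeBot := by
    rw [nhdsWithin_Ioc_eq_nhdsGT zero_lt_one]; infer_instance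
  refine ge_of_tendsto hd ?_
  filter_upwards [self_mem_nhdsWithin] with s hs
  rw [slope_def_field, sub_zero, le_div_iff₀ hs.1, mul_comm]
  simpa using h s hs

theorem convexOn_inner_add {K : Set E} {g : E → ℝ} (hg : ConvexOn ℝ K g) (c p : E) :
    ConvexOn ℝ K fun u => ⟪u - c, p⟫_ℝ + g u := by
  refine ⟨hg.1, fun x hx y hy a b ha hb hab => ?_⟩
  have h1 := hg.2 hx hy ha hb hab
  have h2 : a • x + b • y - c = a • (x - c) + b • (y - c) := by
    rw [smul_sub, smul_sub]
    have : c = a • c + b • c := by rw [← add_smul, hab, one_smul]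
    nth_rw 1 [this]
    abel
  simp only [smul_eq_mul] at h1 ⊢
  rw [h2, inner_add_left, real_inner_smul_left, real_inner_smul_left]
  linarith

/-- All that is used of strong convexity beyond convexity. Working at midpoints is what produces `τ
/ 4` in the quadratic bounds below. -/
theorem _root_.StrongConvexOn.midpoint_le {K : Set E} {τ : ℝ} {f : E → ℝ}
    (hf : StrongConvexOn K τ f) {x w : E} (hx : x ∈ K) (hw : w ∈ K) :
    f (x + (1 / 2 : ℝ) • (w - x)) ≤ (f x + f w) / 2 - τ / 8 * ‖w - x‖ ^ 2 := by
  have h := hf.2 hx hw (show (0 : ℝ) ≤ 1 / 2 by norm_num)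
    (show (0 : ℝ) ≤ 1 / 2 by norm_num) (by norm_num)
  have h2 : x + (1 / 2 : ℝ) • (w - x) = (1 / 2 : ℝ) • x + (1 / 2 : ℝ) • w := by
    rw [smul_sub]
    nth_rw 1 [show x = (1 / 2 : ℝ) • x + (1 / 2 : ℝ) • x by rw [← add_smul]; norm_num]
    abel
  rw [h2, norm_sub_rev w x]
  simp only [smul_eq_mul] at h
  linarith

theorem isMinOn_add_sq_le {K : Set E} {τ : ℝ} {f g : E → ℝ} (hf : StrongConvexOn K τ f)
    (hg : ConvexOn ℝ K g) {c p u : E} (hu : u ∈ K)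
    (hmin : IsMinOn (fun u => f u + ⟪u - c, p⟫_ℝ + g u) K u) {w : E} (hw : w ∈ K) :
    f u + ⟪u - c, p⟫_ℝ + g u + τ / 4 * ‖w - u‖ ^ 2 ≤ f w + ⟪w - c, p⟫_ℝ + g w := by
  have hmid : u + (1 / 2 : ℝ) • (w - u) ∈ K :=
    hf.1.add_smul_sub_mem hu hw ⟨by norm_num, by norm_num⟩
  have h1 := hf.midpoint_le hu hw
  have h2 := (convexOn_inner_add hg c p).2 hu hw (show (0 : ℝ) ≤ 1 / 2 by norm_num)
    (show (0 : ℝ) ≤ 1 / 2 by norm_num) (by norm_num)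
  have h3 : u + (1 / 2 : ℝ) • (w - u) = (1 / 2 : ℝ) • u + (1 / 2 : ℝ) • w := by
    rw [smul_sub]
    nth_rw 1 [show u = (1 / 2 : ℝ) • u + (1 / 2 : ℝ) • u by rw [← add_smul]; norm_num]
    abel
  have h4 := isMinOn_iff.1 hmin _ hmid
  simp only [smul_eq_mul] at h2
  rw [← h3] at h2
  linarith

section Gradient

variable [CompleteSpace E]

theorem _root_.ConvexOn.add_inner_gradient_le {f : E → ℝ} {K : Set E} (hf : ConvexOn ℝ K f)
    {x w D : E} (hx : x ∈ K) (hw : w ∈ K) (hD : HasGradientWithinAt f D K x) :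
    f x + ⟪D, w - x⟫_ℝ ≤ f w := by
  have h := le_fderivWithin_of_forall_le (c := f x - f w) hf.1 hx hw
    hD.hasFDerivWithinAt.neg fun s hs => by
      have h1 := hf.2 hx hw (sub_nonneg.2 hs.2) hs.1.le (sub_add_cancel 1 s)
      have h2 : x + s • (w - x) = (1 - s) • x + s • w := by
        rw [smul_sub, sub_smul, one_smul]; abel
      simp only [smul_eq_mul] at h1
      simp only [Pi.neg_apply]
      rw [h2]
      linarith
  simp only [neg_apply, InnerProductSpace.toDual_apply_apply] at h
  linarith

theorem _root_.StrongConvexOn.add_inner_gradient_le {f : E → ℝ} {K : Set E} {τ : ℝ} (hτ : 0 ≤ τ)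
    (hf : StrongConvexOn K τ f) {x w D : E} (hx : x ∈ K) (hw : w ∈ K)
    (hD : HasGradientWithinAt f D K x) :
    f x + ⟪D, w - x⟫_ℝ + τ / 4 * ‖w - x‖ ^ 2 ≤ f w := by
  have hc : ConvexOn ℝ K f := strongConvexOn_zero.1 (hf.mono hτ)
  have hmid : x + (1 / 2 : ℝ) • (w - x) ∈ K :=
    hf.1.add_smul_sub_mem hx hw ⟨by norm_num, by norm_num⟩
  have h1 := hf.midpoint_le hx hw
  have h2 := hc.add_inner_gradient_le hx hmid hD
  rw [add_sub_cancel_left, real_inner_smul_right] at h2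
  linarith

/-- Minimizers of perturbed strongly convex functions. -/
theorem norm_isMinOn_sub_le {K : Set E} {τ δ : ℝ} (hτ : 0 < τ) {f₁ f₂ g : E → ℝ} {D₁ D₂ : E → E}
    (hf₁ : StrongConvexOn K τ f₁) (hf₂ : StrongConvexOn K τ f₂) (hg : ConvexOn ℝ K g)
    (hD₁ : ∀ u ∈ K, HasGradientWithinAt f₁ (D₁ u) K u)
    (hD₂ : ∀ u ∈ K, HasGradientWithinAt f₂ (D₂ u) K u)
    (hδ : ∀ u ∈ K, ‖D₁ u - D₂ u‖ ≤ δ) {c₁ c₂ p₁ p₂ u₁ u₂ : E} (hu₁ : u₁ ∈ K) (hu₂ : u₂ ∈ K)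
    (hmin₁ : IsMinOn (fun u => f₁ u + ⟪u - c₁, p₁⟫_ℝ + g u) K u₁)
    (hmin₂ : IsMinOn (fun u => f₂ u + ⟪u - c₂, p₂⟫_ℝ + g u) K u₂) :
    ‖u₁ - u₂‖ ≤ 2 / τ * (δ + ‖p₁ - p₂‖) := by
  have h1 := isMinOn_add_sq_le hf₁ hg hu₁ hmin₁ hu₂
  have h2 := isMinOn_add_sq_le hf₂ hg hu₂ hmin₂ hu₁
  -- Adding `h1` and `h2` cancels `g` and the centers `c₁`, `c₂`. What remains of the smooth parts
  -- is an increment of `f₁ - f₂`, whose gradient is at most `δ`.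
  have h3 : ‖(f₁ u₂ - f₂ u₂) - (f₁ u₁ - f₂ u₁)‖ ≤ δ * ‖u₂ - u₁‖ := by
    refine hf₁.1.norm_image_sub_le_of_norm_hasFDerivWithin_le (f := fun u => f₁ u - f₂ u)
      (fun u hu => (hD₁ u hu).hasFDerivWithinAt.sub (hD₂ u hu).hasFDerivWithinAt)
      (fun u hu => ?_) hu₁ hu₂
    rw [← map_sub, LinearIsometryEquiv.norm_map]
    exact hδ u hu
  have h4 := real_inner_le_norm (u₂ - u₁) (p₁ - p₂)
  have h5 : ⟪u₂ - u₁, p₁ - p₂⟫_ℝ = (⟪u₂ - c₁, p₁⟫_ℝ - ⟪u₁ - c₁, p₁⟫_ℝ)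
      - (⟪u₂ - c₂, p₂⟫_ℝ - ⟪u₁ - c₂, p₂⟫_ℝ) := by
    rw [← inner_sub_left, ← inner_sub_left, inner_sub_right]
    simp only [sub_sub_sub_cancel_right]
  rw [norm_sub_rev u₁ u₂] at h2 ⊢
  have h6 := (le_abs_self _).trans h3
  have h7 : τ / 2 * ‖u₂ - u₁‖ ^ 2 ≤ (δ + ‖p₁ - p₂‖) * ‖u₂ - u₁‖ := by linarith
  rcases (norm_nonneg (u₂ - u₁)).eq_or_lt with h0 | h0
  · rw [← h0]
    have := (norm_nonneg _).trans (hδ u₁ hu₁)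
    positivity
  · have h8 : τ / 2 * ‖u₂ - u₁‖ ≤ δ + ‖p₁ - p₂‖ := by
      refine le_of_mul_le_mul_right ?_ h0
      linarith
    calc ‖u₂ - u₁‖ = 2 / τ * (τ / 2 * ‖u₂ - u₁‖) := by field_simp
      _ ≤ _ := mul_le_mul_of_nonneg_left h8 (by positivity)

/-- The minimizer of a strongly convex model centered at `x` gives a descent direction. -/
theorem inner_add_sub_le_of_isMinOn {K : Set E} {τ : ℝ} (hτ : 0 ≤ τ) {f g : E → ℝ}
    (hf : StrongConvexOn K τ f) (hg : ConvexOn ℝ K g) {x u p D : E} (hx : x ∈ K) (hu : u ∈ K)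
    (hD : HasGradientWithinAt f D K x)
    (hmin : IsMinOn (fun u => f u + ⟪u - x, p⟫_ℝ + g u) K u) :
    ⟪D + p, u - x⟫_ℝ + g u - g x ≤ -(τ / 2 * ‖u - x‖ ^ 2) := by
  have h1 := isMinOn_add_sq_le hf hg hu hmin hx
  have h2 := hf.add_inner_gradient_le hτ hx hu hD
  rw [norm_sub_rev x u, sub_self, inner_zero_left] at h1
  rw [inner_add_left, real_inner_comm (u - x) p]
  linarith

/-- First-order optimality at a fixed point of the best response: the smooth part is differentiated
along a segment, while convexity bounds the increment of `g`. -/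
theorem inner_add_sub_nonneg_of_isMinOn {K : Set E} {f g : E → ℝ} (hg : ConvexOn ℝ K g)
    {x p D w : E} (hx : x ∈ K) (hw : w ∈ K) (hD : HasGradientWithinAt f D K x)
    (hmin : IsMinOn (fun u => f u + ⟪u - x, p⟫_ℝ + g u) K x) :
    0 ≤ ⟪D + p, w - x⟫_ℝ + g w - g x := by
  have h := le_fderivWithin_of_forall_le (c := -(⟪w - x, p⟫_ℝ + g w - g x)) hg.1 hx hw
    hD.hasFDerivWithinAt fun s hs => by
      have h1 := isMinOn_iff.1 hmin _ (hg.1.add_smul_sub_mem hx hw ⟨hs.1.le, hs.2⟩)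
      have h2 := hg.2 hx hw (sub_nonneg.2 hs.2) hs.1.le (sub_add_cancel 1 s)
      have h3 : x + s • (w - x) = (1 - s) • x + s • w := by
        rw [smul_sub, sub_smul, one_smul]; abel
      simp only [smul_eq_mul] at h2
      simp only [sub_self, inner_zero_left, add_sub_cancel_left, real_inner_smul_left] at h1
      rw [← h3] at h2
      linarith
  rw [InnerProductSpace.toDual_apply_apply] at h
  rw [inner_add_left, real_inner_comm (w - x) p]
  linarith

/-- The quadratic decrease is paid for by terms linear in `‖u - x‖`, which bounds the step. This is
the source of the bound on the directions. -/
theorem norm_sub_le_of_isMinOn {K : Set E} {τ C : ℝ} (hτ : 0 < τ) {f g : E → ℝ}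
    (hf : StrongConvexOn K τ f) (hg : ConvexOn ℝ K g) {x u p D : E} (hx : x ∈ K) (hu : u ∈ K)
    (hD : HasGradientWithinAt f D K x) (hgC : |g u - g x| ≤ C * ‖u - x‖)
    (hmin : IsMinOn (fun u => f u + ⟪u - x, p⟫_ℝ + g u) K u) (hC : 0 ≤ C) :
    ‖u - x‖ ≤ 2 / τ * (‖D + p‖ + C) := by
  have h1 := inner_add_sub_le_of_isMinOn hτ.le hf hg hx hu hD hmin
  have h2 := (abs_le.1 (abs_real_inner_le_norm (D + p) (u - x))).1
  have h3 := (abs_le.1 hgC).1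
  rcases (norm_nonneg (u - x)).eq_or_lt with h0 | h0
  · rw [← h0]
    positivity
  · have h8 : τ / 2 * ‖u - x‖ ≤ ‖D + p‖ + C := by
      refine le_of_mul_le_mul_right ?_ h0
      linarith
    calc ‖u - x‖ = 2 / τ * (τ / 2 * ‖u - x‖) := by field_simp
      _ ≤ _ := mul_le_mul_of_nonneg_left h8 (by positivity)

theorem exists_isMinOn [FiniteDimensional ℝ E] {K : Set E} {τ C : ℝ} (hτ : 0 < τ)
    (hK : IsClosed K) {f g : E → ℝ} {D : E → E} (hf : StrongConvexOn K τ f) (hgc : ContinuousOn g K)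
    {x p : E} (hx : x ∈ K) (hD : ∀ u ∈ K, HasGradientWithinAt f (D u) K u)
    (hg : ∀ u ∈ K, |g u - g x| ≤ C * ‖u - x‖) :
    ∃ u ∈ K, IsMinOn (fun u => f u + ⟪u - x, p⟫_ℝ + g u) K u := by
  have hcont : ContinuousOn (fun u => f u + ⟪u - x, p⟫_ℝ + g u) K := by
    refine ContinuousOn.add (ContinuousOn.add
      (fun u hu => (hD u hu).continuousWithinAt) ?_) hgc
    fun_prop
  refine hcont.exists_isMinOn' hK hx ?_
  -- Beyond this radius the quadratic growth `τ / 4 * ‖u - x‖ ^ 2` dominates all the linear terms.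
  set R := 4 / τ * (‖D x‖ + ‖p‖ + C) with hR
  have hev : ∀ᶠ u in Filter.cocompact E, u ∉ Metric.closedBall x R :=
    (isCompact_closedBall x R).compl_mem_cocompact
  filter_upwards [hev.filter_mono inf_le_left,
    Filter.mem_inf_of_right (Filter.mem_principal_self K)] with u hu huK
  rw [Metric.mem_closedBall, dist_eq_norm, not_le] at hu
  have h1 := hf.add_inner_gradient_le hτ.le hx huK (hD x hx)
  have h2 := (abs_le.1 (abs_real_inner_le_norm (D x) (u - x))).1
  have h3 := (abs_le.1 (abs_real_inner_le_norm (u - x) p)).1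
  have h4 := (abs_le.1 (hg u huK)).1
  have h5 : (‖D x‖ + ‖p‖ + C) * ‖u - x‖ ≤ τ / 4 * ‖u - x‖ ^ 2 := by
    have : ‖D x‖ + ‖p‖ + C ≤ τ / 4 * ‖u - x‖ := by
      calc ‖D x‖ + ‖p‖ + C = τ / 4 * R := by rw [hR]; field_simp
        _ ≤ _ := mul_le_mul_of_nonneg_left hu.le (by positivity)
    nlinarith [norm_nonneg (u - x)]
  rw [sub_self, inner_zero_left]
  linarith

/-- Descent inequality for a function with Lipschitz gradient. -/
theorem le_add_inner_gradient_add_sq {K : Set E} (hK : Convex ℝ K) {f : E → ℝ} {L : NNReal}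
    (hf : ∀ x ∈ K, DifferentiableAt ℝ f x) (hL : LipschitzOnWith L (gradient f) K) {x y : E}
    (hx : x ∈ K) (hy : y ∈ K) :
    f y ≤ f x + ⟪gradient f x, y - x⟫_ℝ + L * ‖y - x‖ ^ 2 := by
  have hseg : segment ℝ x y ⊆ K := hK.segment_subset hx hy
  -- The mean value inequality on the segment, where the gradient varies by at most `L * ‖y - x‖`;
  -- hence the constant `L` and not `L / 2`.
  have h := (convex_segment x y).norm_image_sub_le_of_norm_hasFDerivWithin_le' (f := f)
    (φ := InnerProductSpace.toDual ℝ E (gradient f x)) (C := L * ‖y - x‖)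
    (fun z hz => (hf z (hseg hz)).hasGradientAt.hasFDerivAt.hasFDerivWithinAt)
    (fun z hz => by
      rw [← map_sub, LinearIsometryEquiv.norm_map, ← dist_eq_norm]
      refine (hL.dist_le_mul z (hseg hz) x hx).trans ?_
      refine mul_le_mul_of_nonneg_left ?_ L.2
      rw [dist_eq_norm]
      exact norm_sub_le_of_mem_segment hz)
    (left_mem_segment ℝ x y) (right_mem_segment ℝ x y)
  have h1 := (le_abs_self _).trans h
  rw [InnerProductSpace.toDual_apply_apply] at h1
  nlinarith

theorem abs_sub_le_of_gradient_bounded {K : Set E} (hK : Convex ℝ K) {f : E → ℝ} {C : ℝ}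
    (hf : ∀ x ∈ K, DifferentiableAt ℝ f x) (hC : ∀ x ∈ K, ‖gradient f x‖ ≤ C) {x y : E}
    (hx : x ∈ K) (hy : y ∈ K) : |f y - f x| ≤ C * ‖y - x‖ :=
  hK.norm_image_sub_le_of_norm_hasFDerivWithin_le
    (fun z hz => (hf z hz).hasGradientAt.hasFDerivAt.hasFDerivWithinAt)
    (fun z hz => by rw [LinearIsometryEquiv.norm_map]; exact hC z hz) hx hy

end Gradient

end ConvexAnalysis

/-! ### Subgradients by separation of convex sets -/

section Subgradient

variable {d : ℕ} {Ω K : Set (Blk d)} {g : Blk d → ℝ}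

/-- A solution of the variational inequality for a convex function satisfies it with a
subgradient. -/
theorem exists_isSubgradientOn_inner_nonneg (hΩ : IsOpen Ω) (hg : ConvexOn ℝ Ω g) (hK : Convex ℝ K)
    (hKΩ : K ⊆ Ω) {x a : Blk d} (hx : x ∈ K) (h : ∀ w ∈ K, 0 ≤ ⟪a, w - x⟫_ℝ + g w - g x) :
    ∃ ξ, IsSubgradientOn Ω g x ξ ∧ ∀ w ∈ K, 0 ≤ ⟪a + ξ, w - x⟫_ℝ := by
  have hopen : IsOpen {p : Blk d × ℝ | p.1 ∈ Ω ∧ g p.1 < p.2} := by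
    have hc : ContinuousOn (fun p : Blk d × ℝ => g p.1 - p.2) (Ω ×ˢ Set.univ) :=
      ((hg.continuousOn hΩ).comp continuousOn_fst fun p hp => hp.1).sub continuousOn_snd
    have := hc.isOpen_inter_preimage (hΩ.prod isOpen_univ) isOpen_Iio (t := Set.Iio 0)
    convert this using 1
    ext p
    simp
  have hconv : Convex ℝ {p : Blk d × ℝ | p.1 ∈ K ∧ p.2 ≤ g x - ⟪a, p.1 - x⟫_ℝ} := by
    rintro p ⟨hp1, hp2⟩ q ⟨hq1, hq2⟩ s t hs ht hst
    refine ⟨hK hp1 hq1 hs ht hst, ?_⟩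
    have h1 : (s • p + t • q).1 - x = s • (p.1 - x) + t • (q.1 - x) := by
      have : x = s • x + t • x := by rw [← add_smul, hst, one_smul]
      rw [smul_sub, smul_sub, Prod.fst_add, Prod.smul_fst, Prod.smul_fst]
      nth_rw 1 [this]
      abel
    rw [h1, inner_add_right, real_inner_smul_right, real_inner_smul_right]
    simp only [Prod.snd_add, Prod.smul_snd, smul_eq_mul]
    have h2 : g x = s * g x + t * g x := by rw [← add_mul, hst, one_mul]
    nlinarith [mul_le_mul_of_nonneg_left hp2 hs, mul_le_mul_of_nonneg_left hq2 ht]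
  -- The open strict epigraph of `g` over `Ω` is separated from the region over `K` below the affine
  -- function `g x - ⟪a, · - x⟫`; they are disjoint by `h`.
  obtain ⟨F, u, hF1, hF2⟩ := geometric_hahn_banach_open hg.convex_strict_epigraph hopen hconv (by
    rw [Set.disjoint_left]
    rintro p ⟨-, hp⟩ ⟨hpK, hp'⟩
    linarith [h p.1 hpK])
  set L : Blk d →L[ℝ] ℝ := F.comp (ContinuousLinearMap.inl ℝ (Blk d) ℝ)
  set b : ℝ := F (0, 1)
  have hF : ∀ y r, F (y, r) = L y + r * b := by
    intro y r
    have : ((y, r) : Blk d × ℝ) = (y, 0) + r • (0, 1) := by simp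
    rw [this, map_add, map_smul, smul_eq_mul]
    rfl
  have hx1 := hF1 (x, g x + 1) ⟨hKΩ hx, by simp⟩
  have hx2 := hF2 (x, g x) ⟨hx, by simp⟩
  rw [hF] at hx1 hx2
  -- Two points above `x` show that the hyperplane is not vertical; its normal rescaled by `-b`
  -- gives the subgradient.
  have hb : b < 0 := by linarith
  have hΩ' : ∀ y ∈ Ω, L y + g y * b ≤ u := by
    intro y hy
    refine le_of_forall_pos_lt_add fun ε hε => ?_
    have := hF1 (y, g y + ε / (-b)) ⟨hy, by simpa using div_pos hε (neg_pos.2 hb)⟩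
    rw [hF] at this
    have h2 : ε / (-b) * b = -ε := by rw [div_neg, neg_mul, div_mul_cancel₀ _ hb.ne]
    linarith
  obtain ⟨v, hv⟩ := (InnerProductSpace.toDual ℝ (Blk d)).surjective L
  have hLv : ∀ y, L y = ⟪v, y⟫_ℝ := fun y => by rw [← hv, InnerProductSpace.toDual_apply_apply]
  have hξ : ∀ y, ⟪(-b)⁻¹ • v, y - x⟫_ℝ = (L y - L x) / (-b) := fun y => by
    rw [real_inner_smul_left, inner_sub_right, hLv, hLv, div_eq_inv_mul]
  refine ⟨(-b)⁻¹ • v, fun y hy => ?_, fun w hw => ?_⟩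
  · rw [hξ, ← le_sub_iff_add_le', div_le_iff₀ (neg_pos.2 hb)]
    linarith [hΩ' y hy]
  · have h1 := hF2 (w, g x - ⟪a, w - x⟫_ℝ) ⟨hw, le_rfl⟩
    have h2 := hΩ' x (hKΩ hx)
    rw [hF] at h1
    rw [inner_add_left, hξ, ← sub_le_iff_le_add', zero_sub, le_div_iff₀ (neg_pos.2 hb)]
    linarith

theorem abs_sub_le_of_subgradient_bounded (hΩ : IsOpen Ω) (hg : ConvexOn ℝ Ω g) (hKΩ : K ⊆ Ω)
    {C : ℝ} (hC : ∀ x ∈ K, ∀ ξ, IsSubgradientOn Ω g x ξ → ‖ξ‖ ≤ C) {x y : Blk d} (hx : x ∈ K)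
    (hy : y ∈ K) : |g y - g x| ≤ C * ‖y - x‖ := by
  have key : ∀ x ∈ K, ∀ y ∈ K, g x - g y ≤ C * ‖y - x‖ := by
    intro x hx y hy
    -- For `K = {x}` and `a = 0` the variational inequality is trivial, and what remains is the
    -- existence of a subgradient.
    obtain ⟨ξ, hξ, -⟩ := exists_isSubgradientOn_inner_nonneg (K := {x}) (a := 0) hΩ hg
      (convex_singleton x) (Set.singleton_subset_iff.2 (hKΩ hx)) rfl (by simp)
    have h1 := hξ y (hKΩ hy)
    have h2 := (abs_le.1 (abs_real_inner_le_norm ξ (y - x))).1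
    have h3 := mul_le_mul_of_nonneg_right (hC x hx ξ hξ) (norm_nonneg (y - x))
    linarith
  rw [abs_le]
  constructor
  · linarith [key x hx y hy]
  · have := key y hy x hx
    rwa [norm_sub_rev] at this

end Subgradient

/-! ### Consensus and gradient tracking -/

section Blocks

variable {B d : ℕ}

theorem norm_block_le (x : Var B d) (ℓ : Fin B) : ‖x ℓ‖ ≤ ‖x‖ := PiLp.norm_apply_le x ℓ

theorem norm_le_sum_block (x : Var B d) : ‖x‖ ≤ ∑ ℓ, ‖x ℓ‖ := by
  rw [PiLp.norm_eq_of_L2]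
  refine Real.sqrt_le_iff.2 ⟨Finset.sum_nonneg fun _ _ => norm_nonneg _, ?_⟩
  exact Finset.sum_sq_le_sq_sum_of_nonneg fun _ _ => norm_nonneg _

end Blocks

/-! ### Uniform constants for the problem data -/

namespace Problem

variable {N B d : ℕ} {P : Problem N B d}

/-- The gradient of `∑ i, f i`. -/
def gradF (P : Problem N B d) (x : Var B d) : Var B d := ∑ i, gradient (P.f i) x

theorem gradF_block (x : Var B d) (ℓ : Fin B) : P.gradF x ℓ = ∑ i, gradient (P.f i) x ℓ := by
  simp [gradF]

theorem Assumptions.convex_feasible (h : P.Assumptions) : Convex ℝ P.feasible :=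
  fun _ hx _ hy _ _ ha hb hab ℓ => h.convex ℓ (hx ℓ) (hy ℓ) ha hb hab

theorem Assumptions.isClosed_feasible (h : P.Assumptions) : IsClosed P.feasible := by
  have : P.feasible = ⋂ ℓ, (fun x : Var B d => x ℓ) ⁻¹' P.K ℓ := by
    ext x; simp [feasible]
  rw [this]
  exact isClosed_iInter fun ℓ => (h.closed ℓ).preimage (by fun_prop)

theorem Assumptions.differentiableAt (h : P.Assumptions) (i : Fin N) :
    ∀ x ∈ P.feasible, DifferentiableAt ℝ (P.f i) x := fun x hx => by
  obtain ⟨O, hO, hKO, hf⟩ := h.f_contDiff i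
  exact (hf.differentiableOn one_ne_zero).differentiableAt (hO.mem_nhds (hKO hx))

theorem Assumptions.g_convexOn (h : P.Assumptions) (ℓ : Fin B) : ConvexOn ℝ (P.K ℓ) (P.g ℓ) :=
  (h.g_convex ℓ).subset (h.g_subset ℓ) (h.convex ℓ)

theorem Assumptions.exists_lipschitz (h : P.Assumptions) : ∃ L : NNReal, ∀ i,
    LipschitzOnWith L (gradient (P.f i)) P.feasible := by
  choose L hL using h.grad_lipschitz
  exact ⟨∑ i, L i, fun i => (hL i).weaken
    (Finset.single_le_sum (fun _ _ => zero_le) (Finset.mem_univ i))⟩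

theorem norm_gradient_sub_le {L : NNReal} {i : Fin N}
    (h : LipschitzOnWith L (gradient (P.f i)) P.feasible) {x y : Var B d} (hx : x ∈ P.feasible)
    (hy : y ∈ P.feasible) (ℓ : Fin B) :
    ‖gradient (P.f i) x ℓ - gradient (P.f i) y ℓ‖ ≤ L * ‖x - y‖ := by
  have := h.dist_le_mul x hx y hy
  rw [dist_eq_norm, dist_eq_norm] at this
  exact (norm_block_le (gradient (P.f i) x - gradient (P.f i) y) ℓ).trans this

theorem Assumptions.exists_grad_bound (h : P.Assumptions) : ∃ C, 0 < C ∧ ∀ i, ∀ x ∈ P.feasible,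
    ‖gradient (P.f i) x‖ ≤ C := by
  obtain ⟨C, hC, hb⟩ := exists_uniform_bound
    (p := fun i (x : P.feasible) => ‖gradient (P.f i) x.1‖)
    fun i => (h.grad_bounded i).imp fun C hC x => hC x.1 x.2
  exact ⟨C, hC, fun i x hx => hb i ⟨x, hx⟩⟩

theorem Assumptions.exists_g_lipschitz (h : P.Assumptions) : ∃ C, 0 < C ∧ ∀ ℓ, ∀ x ∈ P.K ℓ,
    ∀ y ∈ P.K ℓ, |P.g ℓ y - P.g ℓ x| ≤ C * ‖y - x‖ := by
  choose c hc using h.subgrad_bounded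
  obtain ⟨C, hC, hb⟩ := exists_uniform_bound (p := fun ℓ (_ : Unit) => c ℓ)
    fun ℓ => ⟨c ℓ, fun _ => le_rfl⟩
  exact ⟨C, hC, fun ℓ x hx y hy => (abs_sub_le_of_subgradient_bounded (h.g_open ℓ) (h.g_convex ℓ)
    (h.g_subset ℓ) (hc ℓ) hx hy).trans (mul_le_mul_of_nonneg_right (hb ℓ ()) (norm_nonneg _))⟩

end Problem

/-- A run of the algorithm together with all the assumptions of the convergence theorem. -/
structure Admissible {N B d : ℕ} (P : Problem N B d) (ft : Fin N → Fin B → Blk d → Var B d → ℝ)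
    (G : Digraph (Fin N)) (blk : ℕ → Fin N → Fin B) (A : ℕ → Fin B → Matrix (Fin N) (Fin N) ℝ)
    (γ : ℕ → ℝ) (R : Run N B d) : Prop where
  pos : 0 < N
  problem : P.Assumptions
  graph : StronglyConnected G
  weights : WeightsMatch G blk A
  column : ColumnStochastic A
  cyclic : EssentiallyCyclic blk
  surrogate : P.SurrogateAssumptions ft
  step : StepSize γ
  run : R.IsGenerated P ft G blk A γ

/-- The row stochastic weights `a_ij φ_j / φ_i⁺` with which block `ℓ` is averaged. -/
def Run.avgWeights {N B d : ℕ} (R : Run N B d) (A : ℕ → Fin B → Matrix (Fin N) (Fin N) ℝ)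
    (ℓ : Fin B) (t : ℕ) : Matrix (Fin N) (Fin N) ℝ :=
  fun i j => (R.φ (t + 1) i ℓ)⁻¹ * (A t ℓ i j * R.φ t j ℓ)

/-- The direction `x̃ - x` of agent `i` at time `t`. -/
def Run.dir {N B d : ℕ} (R : Run N B d) (blk : ℕ → Fin N → Fin B) (t : ℕ) (i : Fin N) : Blk d :=
  R.xt t i - R.x t i (blk t i)

namespace Admissible

variable {N B d : ℕ} {P : Problem N B d} {ft : Fin N → Fin B → Blk d → Var B d → ℝ}
  {G : Digraph (Fin N)} {blk : ℕ → Fin N → Fin B} {A : ℕ → Fin B → Matrix (Fin N) (Fin N) ℝ}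
  {γ : ℕ → ℝ} {R : Run N B d}

theorem nonempty (S : Admissible P ft G blk A γ R) : Nonempty (Fin N) := ⟨⟨0, S.pos⟩⟩

theorem cast_pos (S : Admissible P ft G blk A γ R) : (0 : ℝ) < N := by exact_mod_cast S.pos

theorem exists_window (S : Admissible P ft G blk A γ R) :
    ∃ T, ∀ t i ℓ, ∃ s < T, blk (t + s) i = ℓ := by
  choose T hT hTu using S.cyclic
  refine ⟨∑ i, T i, fun t i ℓ => ?_⟩
  have h : ℓ ∈ ⋃ s ∈ Finset.range (T i), {blk (t + s) i} := by rw [hTu i t]; trivial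
  simp only [Set.mem_iUnion, Finset.mem_range, Set.mem_singleton_iff, exists_prop] at h
  obtain ⟨s, hs, h⟩ := h
  exact ⟨s, hs.trans_le (Finset.single_le_sum (fun _ _ => Nat.zero_le _) (Finset.mem_univ i)),
    h.symm⟩

theorem jointlyPositive (S : Admissible P ft G blk A γ R) (ℓ : Fin B) :
    ∃ θ T, θ ≤ 1 ∧ JointlyPositive G.Adj (fun t => A t ℓ) θ T := by
  obtain ⟨θ, hθ, hA⟩ := S.weights
  obtain ⟨T, hT⟩ := S.exists_window
  refine ⟨θ, T, hθ.2.le, hθ.1, fun t i j => ?_, fun t i => ?_, fun t i j hij => ?_⟩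
  · by_cases hj : j ∈ blockNbr G (blk t) ℓ i
    · exact hθ.1.le.trans ((hA t ℓ i j).1 hj).1
    · exact ((hA t ℓ i j).2 hj).ge
  · exact ((hA t ℓ i i).1 (by simp [blockNbr])).1
  · obtain ⟨s, hs, h⟩ := hT t j ℓ
    exact ⟨s, hs, ((hA (t + s) ℓ i j).1 (by simp [blockNbr, inNbr, hij, h])).1⟩

theorem weight_nonneg (S : Admissible P ft G blk A γ R) (t : ℕ) (ℓ : Fin B) (i j : Fin N) :
    0 ≤ A t ℓ i j := by
  obtain ⟨θ, T, -, h⟩ := S.jointlyPositive ℓ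
  exact h.nonneg t i j

/-- Weights vanish outside the in-neighborhood, so the updates become full matrix products. -/
theorem sum_inNbr (S : Admissible P ft G blk A γ R) {E : Type*} [AddCommMonoid E] (t : ℕ)
    (ℓ : Fin B) (i : Fin N) (h : Fin N → E) (h0 : ∀ j, A t ℓ i j = 0 → h j = 0) :
    ∑ j ∈ inNbr G i, h j = ∑ j, h j := by
  refine Finset.sum_subset (Finset.subset_univ _) fun j _ hj => h0 j ?_
  obtain ⟨θ, -, hA⟩ := S.weights
  refine (hA t ℓ i j).2 fun hj' => hj ?_
  simp only [blockNbr, Finset.mem_union, Finset.mem_filter, Finset.mem_singleton] at hj'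
  rcases hj' with h | rfl
  · exact h.1
  · simp [inNbr]

theorem φ_succ (S : Admissible P ft G blk A γ R) (t : ℕ) (i : Fin N) (ℓ : Fin B) :
    R.φ (t + 1) i ℓ = ∑ j, A t ℓ i j * R.φ t j ℓ := by
  rw [S.run.φ_succ]
  exact S.sum_inNbr t ℓ i _ fun j hj => by rw [hj, zero_mul]

theorem sum_φ (S : Admissible P ft G blk A γ R) (t : ℕ) (ℓ : Fin B) : ∑ i, R.φ t i ℓ = N := by
  obtain ⟨θ, T, hθ, h⟩ := S.jointlyPositive ℓ
  have := S.nonempty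
  simpa using (h.exists_lower_bound hθ S.graph (φ := fun t i => R.φ t i ℓ)
    (fun i => S.run.φ_zero i ℓ) (fun t i => S.φ_succ t i ℓ) (fun t j => S.column t ℓ j)).1 t

theorem exists_φ_lower_bound (S : Admissible P ft G blk A γ R) :
    ∃ c, 0 < c ∧ ∀ t i ℓ, c ≤ R.φ t i ℓ := by
  have := S.nonempty
  have h1 : ∀ ℓ, ∃ c, 0 < c ∧ ∀ t i, c ≤ R.φ t i ℓ := fun ℓ => by
    obtain ⟨θ, T, hθ, h⟩ := S.jointlyPositive ℓ
    exact (h.exists_lower_bound hθ S.graph (φ := fun t i => R.φ t i ℓ)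
      (fun i => S.run.φ_zero i ℓ) (fun t i => S.φ_succ t i ℓ) (fun t j => S.column t ℓ j)).2
  choose c hc0 hc using h1
  -- A common positive lower bound is the reciprocal of a common upper bound of the reciprocals.
  obtain ⟨C, hC0, hC⟩ := exists_uniform_bound (p := fun ℓ (_ : Unit) => (c ℓ)⁻¹)
    fun ℓ => ⟨(c ℓ)⁻¹, fun _ => le_rfl⟩
  exact ⟨C⁻¹, inv_pos.2 hC0, fun t i ℓ => (inv_le_of_inv_le₀ (hc0 ℓ) (hC ℓ ())).trans (hc ℓ t i)⟩

theorem φ_pos (S : Admissible P ft G blk A γ R) (t : ℕ) (i : Fin N) (ℓ : Fin B) :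
    0 < R.φ t i ℓ := by
  obtain ⟨c, hc, h⟩ := S.exists_φ_lower_bound
  exact hc.trans_le (h t i ℓ)

theorem φ_le (S : Admissible P ft G blk A γ R) (t : ℕ) (i : Fin N) (ℓ : Fin B) :
    R.φ t i ℓ ≤ N := by
  rw [← S.sum_φ t ℓ]
  exact Finset.single_le_sum (f := fun i => R.φ t i ℓ) (fun j _ => (S.φ_pos t j ℓ).le)
    (Finset.mem_univ i)

theorem avgWeights_rowStochastic (S : Admissible P ft G blk A γ R) (ℓ : Fin B) :
    RowStochastic (R.avgWeights A ℓ) := fun t i => by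
  simp only [Run.avgWeights]
  rw [← Finset.mul_sum, ← S.φ_succ, inv_mul_cancel₀ (S.φ_pos _ _ _).ne']

theorem avgWeights_nonneg (S : Admissible P ft G blk A γ R) (ℓ : Fin B) (t : ℕ) (i j : Fin N) :
    0 ≤ R.avgWeights A ℓ t i j :=
  mul_nonneg (inv_pos.2 (S.φ_pos _ _ _)).le (mul_nonneg (S.weight_nonneg _ _ _ _) (S.φ_pos _ _ _).le)

theorem avgWeights_le_one (S : Admissible P ft G blk A γ R) (ℓ : Fin B) (t : ℕ) (i j : Fin N) :
    R.avgWeights A ℓ t i j ≤ 1 := by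
  rw [← S.avgWeights_rowStochastic ℓ t i]
  exact Finset.single_le_sum (fun j _ => S.avgWeights_nonneg ℓ t i j) (Finset.mem_univ j)

/-- Since `c ≤ φ ≤ N`, the normalization costs at most a factor `c / N` in the lower bounds. -/
theorem avgWeights_jointlyPositive (S : Admissible P ft G blk A γ R) (ℓ : Fin B) :
    ∃ κ T, JointlyPositive G.Adj (R.avgWeights A ℓ) κ T := by
  obtain ⟨θ, T, hθ, h⟩ := S.jointlyPositive ℓ
  obtain ⟨c, hc, hφ⟩ := S.exists_φ_lower_bound
  have key : ∀ t i j, θ ≤ A t ℓ i j → (N : ℝ)⁻¹ * (θ * c) ≤ R.avgWeights A ℓ t i j :=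
    fun t i j hA => mul_le_mul (inv_anti₀ (S.φ_pos _ _ _) (S.φ_le _ _ _))
      (mul_le_mul hA (hφ _ _ _) hc.le (h.nonneg _ _ _)) (mul_nonneg h.pos.le hc.le)
      (inv_pos.2 (S.φ_pos _ _ _)).le
  refine ⟨(N : ℝ)⁻¹ * (θ * c), T, mul_pos (inv_pos.2 S.cast_pos) (mul_pos h.pos hc),
    fun t i j => S.avgWeights_nonneg ℓ t i j, fun t i => key t i i (h.diag t i),
    fun t i j hij => ?_⟩
  obtain ⟨s, hs, hA⟩ := h.edge t i j hij
  exact ⟨s, hs, key _ _ _ hA⟩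

theorem x_succ (S : Admissible P ft G blk A γ R) (t : ℕ) (i : Fin N) (ℓ : Fin B) :
    R.x (t + 1) i ℓ = ∑ j, R.avgWeights A ℓ t i j • R.v t j ℓ := by
  rw [S.run.x_succ, S.sum_inNbr t ℓ i _ fun j hj => by rw [hj, zero_mul, zero_smul],
    Finset.smul_sum]
  simp only [Run.avgWeights, smul_smul]

theorem y_succ (S : Admissible P ft G blk A γ R) (t : ℕ) (i : Fin N) (ℓ : Fin B) :
    R.y (t + 1) i ℓ = ∑ j, R.avgWeights A ℓ t i j • R.y t j ℓ + (R.φ (t + 1) i ℓ)⁻¹ •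
      (gradient (P.f i) (R.x (t + 1) i) ℓ - gradient (P.f i) (R.x t i) ℓ) := by
  rw [S.run.y_succ, S.sum_inNbr t ℓ i _ fun j hj => by rw [hj, zero_mul, zero_smul],
    add_sub_assoc, smul_add, Finset.smul_sum]
  simp only [Run.avgWeights, smul_smul]

/-- Averaging with weights `φ` commutes with the mixing step. -/
theorem sum_φ_avgWeights (S : Admissible P ft G blk A γ R) (t : ℕ) (ℓ : Fin B) (u : Fin N → Blk d) :
    ∑ i, R.φ (t + 1) i ℓ • ∑ j, R.avgWeights A ℓ t i j • u j = ∑ j, R.φ t j ℓ • u j := by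
  have h1 : ∀ i, R.φ (t + 1) i ℓ • ∑ j, R.avgWeights A ℓ t i j • u j
      = ∑ j, (A t ℓ i j * R.φ t j ℓ) • u j := fun i => by
    simp only [Run.avgWeights, Finset.smul_sum, smul_smul]
    exact Finset.sum_congr rfl fun j _ => by rw [mul_inv_cancel_left₀ (S.φ_pos _ _ _).ne']
  simp only [h1]
  rw [Finset.sum_comm]
  simp only [← Finset.sum_smul, ← Finset.sum_mul, S.column t ℓ, one_mul]

theorem v_mem_of_x_mem (S : Admissible P ft G blk A γ R) {t : ℕ} {i : Fin N}
    (h : R.x t i ∈ P.feasible) : R.v t i ∈ P.feasible := fun ℓ => by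
  by_cases hℓ : ℓ = blk t i
  · subst hℓ
    rw [S.run.v_selected]
    exact (S.problem.convex _).add_smul_sub_mem (h _) (S.run.xt_mem t i)
      ⟨(S.step.pos t).le, S.step.le_one t⟩
  · rw [S.run.v_other t i ℓ hℓ]
    exact h ℓ

theorem x_mem (S : Admissible P ft G blk A γ R) (t : ℕ) : ∀ i, R.x t i ∈ P.feasible := by
  induction t with
  | zero => exact S.run.x_zero
  | succ t ih =>
    intro i ℓ
    rw [S.x_succ]
    exact (S.problem.convex ℓ).sum_mem (fun j _ => S.avgWeights_nonneg ℓ t i j)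
      (S.avgWeights_rowStochastic ℓ t i) fun j _ => S.v_mem_of_x_mem (ih j) ℓ

theorem v_mem (S : Admissible P ft G blk A γ R) (t : ℕ) (i : Fin N) : R.v t i ∈ P.feasible :=
  S.v_mem_of_x_mem (S.x_mem t i)

theorem zbar_block (t : ℕ) (ℓ : Fin B) :
    R.zbar t ℓ = ∑ i, ((N : ℝ)⁻¹ * R.φ t i ℓ) • R.x t i ℓ := by
  simp only [Run.zbar, one_div, Finset.smul_sum, smul_smul]

theorem sum_avg_φ (S : Admissible P ft G blk A γ R) (t : ℕ) (ℓ : Fin B) :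
    ∑ i, (N : ℝ)⁻¹ * R.φ t i ℓ = 1 := by
  rw [← Finset.mul_sum, S.sum_φ, inv_mul_cancel₀ S.cast_pos.ne']

theorem avg_φ_nonneg (S : Admissible P ft G blk A γ R) (t : ℕ) (i : Fin N) (ℓ : Fin B) :
    0 ≤ (N : ℝ)⁻¹ * R.φ t i ℓ :=
  mul_nonneg (inv_pos.2 S.cast_pos).le (S.φ_pos _ _ _).le

theorem avg_φ_le_one (S : Admissible P ft G blk A γ R) (t : ℕ) (i : Fin N) (ℓ : Fin B) :
    (N : ℝ)⁻¹ * R.φ t i ℓ ≤ 1 := by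
  rw [← S.sum_avg_φ t ℓ]
  exact Finset.single_le_sum (f := fun i => (N : ℝ)⁻¹ * R.φ t i ℓ)
    (fun j _ => S.avg_φ_nonneg t j ℓ) (Finset.mem_univ i)

theorem zbar_mem (S : Admissible P ft G blk A γ R) (t : ℕ) : R.zbar t ∈ P.feasible := fun ℓ => by
  rw [zbar_block]
  exact (S.problem.convex ℓ).sum_mem (fun j _ => S.avg_φ_nonneg t j ℓ) (S.sum_avg_φ t ℓ)
    fun j _ => S.x_mem t j ℓ

theorem zbar_succ (S : Admissible P ft G blk A γ R) (t : ℕ) (ℓ : Fin B) :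
    R.zbar (t + 1) ℓ = ∑ i, ((N : ℝ)⁻¹ * R.φ t i ℓ) • R.v t i ℓ := by
  rw [zbar_block]
  simp only [mul_smul, ← Finset.smul_sum, S.x_succ]
  rw [S.sum_φ_avgWeights t ℓ fun j => R.v t j ℓ]

theorem zbar_succ_sub (S : Admissible P ft G blk A γ R) (t : ℕ) (ℓ : Fin B) :
    R.zbar (t + 1) ℓ - R.zbar t ℓ
      = ∑ i, ((N : ℝ)⁻¹ * R.φ t i ℓ) • (R.v t i ℓ - R.x t i ℓ) := by
  rw [S.zbar_succ, zbar_block, ← Finset.sum_sub_distrib]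
  simp only [smul_sub]

/-- The conservation law of gradient tracking: mixing preserves the weighted sum, and the added
gradient increments telescope from the initialization `y = ∇f`. -/
theorem sum_φ_y (S : Admissible P ft G blk A γ R) (t : ℕ) (ℓ : Fin B) :
    ∑ i, R.φ t i ℓ • R.y t i ℓ = ∑ i, gradient (P.f i) (R.x t i) ℓ := by
  induction t with
  | zero => simp [S.run.φ_zero, S.run.y_zero]
  | succ t ih =>
    simp only [S.y_succ, smul_add]
    rw [Finset.sum_add_distrib, S.sum_φ_avgWeights t ℓ fun j => R.y t j ℓ, ih,
      ← Finset.sum_add_distrib]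
    refine Finset.sum_congr rfl fun i _ => ?_
    rw [smul_smul, mul_inv_cancel₀ (S.φ_pos _ _ _).ne', one_smul, add_sub_cancel]

theorem v_sub_x_selected (S : Admissible P ft G blk A γ R) (t : ℕ) (i : Fin N) :
    R.v t i (blk t i) - R.x t i (blk t i) = γ t • R.dir blk t i := by
  rw [S.run.v_selected, add_sub_cancel_left, Run.dir]

theorem norm_v_sub_x_le (S : Admissible P ft G blk A γ R) (t : ℕ) (i : Fin N) (ℓ : Fin B) :
    ‖R.v t i ℓ - R.x t i ℓ‖ ≤ γ t * ‖R.dir blk t i‖ := by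
  by_cases hℓ : ℓ = blk t i
  · subst hℓ
    rw [S.v_sub_x_selected, norm_smul, Real.norm_of_nonneg (S.step.pos t).le]
  · rw [S.run.v_other t i ℓ hℓ, sub_self, norm_zero]
    exact mul_nonneg (S.step.pos t).le (norm_nonneg _)

/-! ### Boundedness and square-summable errors -/

theorem exists_y_bound (S : Admissible P ft G blk A γ R) :
    ∃ C, 0 < C ∧ ∀ t i ℓ, ‖R.y t i ℓ‖ ≤ C := by
  have := S.nonempty
  obtain ⟨Cg, hCg, hgrad⟩ := S.problem.exists_grad_bound
  obtain ⟨c, hc, hφ⟩ := S.exists_φ_lower_bound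
  have h1 : ∀ ℓ, ∃ C, ∀ t i j, ‖R.y t i ℓ - R.y t j ℓ‖ ≤ C := fun ℓ => by
    obtain ⟨κ, T, hW⟩ := S.avgWeights_jointlyPositive ℓ
    refine hW.bounded_norm_sub S.graph (S.avgWeights_rowStochastic ℓ)
      (u := fun t i => R.y t i ℓ) (ε := c⁻¹ * (Cg + Cg)) fun t i => ?_
    simp only [S.y_succ, add_sub_cancel_left]
    rw [norm_smul, Real.norm_of_nonneg (inv_pos.2 (S.φ_pos _ _ _)).le]
    refine mul_le_mul (inv_anti₀ hc (hφ _ _ _)) ((norm_sub_le _ _).trans (add_le_add ?_ ?_))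
      (norm_nonneg _) (inv_pos.2 hc).le
    · exact (norm_block_le _ _).trans (hgrad i _ (S.x_mem _ _))
    · exact (norm_block_le _ _).trans (hgrad i _ (S.x_mem _ _))
  have h2 : ∀ ℓ, ∃ C, ∀ p : ℕ × Fin N, ‖R.y p.1 p.2 ℓ‖ ≤ C := fun ℓ => by
    obtain ⟨C, hC⟩ := h1 ℓ
    refine ⟨C + Cg, fun ⟨t, i⟩ => ?_⟩
    -- `y` is its deviation from the `φ`-average, bounded by consensus, plus that average, which is
    -- a mean of bounded gradients.
    have h3 : R.y t i ℓ = ∑ j, ((N : ℝ)⁻¹ * R.φ t j ℓ) • (R.y t i ℓ - R.y t j ℓ)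
        + (N : ℝ)⁻¹ • ∑ j, gradient (P.f j) (R.x t j) ℓ := by
      rw [← S.sum_φ_y]
      simp only [smul_sub, Finset.sum_sub_distrib, ← Finset.sum_smul, S.sum_avg_φ, one_smul,
        Finset.smul_sum, smul_smul, sub_add_cancel]
    rw [h3]
    refine norm_add_le_of_le ?_ ?_
    · have : ∑ j, ((N : ℝ)⁻¹ * R.φ t j ℓ) * C = C := by
        rw [← Finset.sum_mul, S.sum_avg_φ, one_mul]
      rw [← this]
      refine norm_sum_le_of_le _ fun j _ => ?_
      rw [norm_smul, Real.norm_of_nonneg (S.avg_φ_nonneg _ _ _)]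
      exact mul_le_mul_of_nonneg_left (hC _ _ _) (S.avg_φ_nonneg _ _ _)
    · rw [norm_smul, Real.norm_of_nonneg (inv_pos.2 S.cast_pos).le, inv_mul_le_iff₀ S.cast_pos]
      have : ‖∑ j, gradient (P.f j) (R.x t j) ℓ‖ ≤ ∑ _j : Fin N, Cg :=
        norm_sum_le_of_le _ fun j _ => (norm_block_le _ _).trans (hgrad j _ (S.x_mem _ _))
      simpa using this
  obtain ⟨C, hC0, hC⟩ := exists_uniform_bound h2
  exact ⟨C, hC0, fun t i ℓ => hC ℓ (t, i)⟩

theorem exists_dir_bound (S : Admissible P ft G blk A γ R) :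
    ∃ C, 0 < C ∧ ∀ t i, ‖R.dir blk t i‖ ≤ C := by
  obtain ⟨Cy, hCy, hy⟩ := S.exists_y_bound
  obtain ⟨Cg, hCg, hg⟩ := S.problem.exists_g_lipschitz
  have hN := S.cast_pos
  have h : ∀ i, ∃ C, ∀ t, ‖R.dir blk t i‖ ≤ C := fun i => by
    obtain ⟨τ, hτ, hconv⟩ := S.surrogate.strongConvex i
    have key : ∀ t, ‖R.dir blk t i‖ ≤ 2 / τ * (‖gradient (P.f i) (R.x t i) (blk t i)
        + R.π t i (blk t i)‖ + Cg) := fun t => by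
      obtain ⟨D, hD, hDg, -⟩ := S.surrogate.grad i (blk t i)
      rw [← hDg _ (S.x_mem t i)]
      exact norm_sub_le_of_isMinOn hτ (hconv _ _ (S.x_mem t i)) (S.problem.g_convexOn _)
        (S.x_mem t i _) (S.run.xt_mem t i) (hD _ (S.x_mem t i) _ (S.x_mem t i _))
        (hg _ _ (S.x_mem t i _) _ (S.run.xt_mem t i)) (S.run.xt_min t i) hCg.le
    -- The initial `π` is arbitrary, so time `0` is treated apart; afterwards `∇f + π = N y` is
    -- bounded.
    refine ⟨max ‖R.dir blk 0 i‖ (2 / τ * (N * Cy + Cg)), fun t => ?_⟩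
    cases t with
    | zero => exact le_max_left _ _
    | succ t =>
      refine (key _).trans (le_trans ?_ (le_max_right _ _))
      rw [S.run.π_succ, add_sub_cancel, norm_smul, Real.norm_of_nonneg hN.le]
      have := hy (t + 1) i (blk (t + 1) i)
      gcongr
  obtain ⟨C, hC0, hC⟩ := exists_uniform_bound h
  exact ⟨C, hC0, fun t i => hC i t⟩

/-- In each block, mixing is perturbed by at most `C * γ t`, which is square-summable. -/
theorem summable_sq_x_sub_x (S : Admissible P ft G blk A γ R) (i j : Fin N) :
    Summable fun t => ‖R.x t i - R.x t j‖ ^ 2 := by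
  have := S.nonempty
  obtain ⟨C, hC0, hC⟩ := S.exists_dir_bound
  have h : ∀ ℓ, Summable fun t => ‖R.x t i ℓ - R.x t j ℓ‖ ^ 2 := fun ℓ => by
    obtain ⟨κ, T, hW⟩ := S.avgWeights_jointlyPositive ℓ
    refine hW.summable_sq_norm_sub S.graph (S.avgWeights_rowStochastic ℓ)
      (u := fun t i => R.x t i ℓ) (fun t i => ?_) (summable_sq_const_mul S.step.sum_sq C) i j
    simp only [S.x_succ, ← Finset.sum_sub_distrib, ← smul_sub]
    have h1 : ‖∑ b, R.avgWeights A ℓ t i b • (R.v t b ℓ - R.x t b ℓ)‖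
        ≤ ∑ b, R.avgWeights A ℓ t i b * (C * γ t) := by
      refine norm_sum_le_of_le _ fun b _ => ?_
      rw [norm_smul, Real.norm_of_nonneg (S.avgWeights_nonneg _ _ _ _)]
      refine mul_le_mul_of_nonneg_left ?_ (S.avgWeights_nonneg _ _ _ _)
      refine (S.norm_v_sub_x_le _ _ _).trans ?_
      rw [mul_comm]
      exact mul_le_mul_of_nonneg_right (hC t b) (S.step.pos t).le
    rwa [← Finset.sum_mul, S.avgWeights_rowStochastic ℓ t i, one_mul] at h1
  refine summable_sq_of_le (summable_sq_sum Finset.univ fun ℓ _ => h ℓ) fun t => ?_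
  rw [abs_of_nonneg (norm_nonneg _)]
  exact norm_le_sum_block _

theorem summable_sq_x_sub_zbar (S : Admissible P ft G blk A γ R) (i : Fin N) :
    Summable fun t => ‖R.x t i - R.zbar t‖ ^ 2 := by
  refine summable_sq_of_le (summable_sq_const_mul
    (summable_sq_sum Finset.univ fun j _ => S.summable_sq_x_sub_x i j) B) fun t => ?_
  rw [abs_of_nonneg (norm_nonneg _)]
  refine (norm_le_sum_block _).trans ?_
  have h : ∀ ℓ, ‖R.x t i ℓ - R.zbar t ℓ‖ ≤ ∑ j, ‖R.x t i - R.x t j‖ := fun ℓ => by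
    have h1 : R.x t i ℓ - R.zbar t ℓ
        = ∑ j, ((N : ℝ)⁻¹ * R.φ t j ℓ) • (R.x t i ℓ - R.x t j ℓ) := by
      simp only [smul_sub, Finset.sum_sub_distrib, ← Finset.sum_smul, S.sum_avg_φ, one_smul,
        zbar_block]
    rw [h1]
    refine norm_sum_le_of_le _ fun j _ => ?_
    rw [norm_smul, Real.norm_of_nonneg (S.avg_φ_nonneg _ _ _)]
    exact (mul_le_of_le_one_left (norm_nonneg _) (S.avg_φ_le_one _ _ _)).trans
      (norm_block_le (R.x t i - R.x t j) ℓ)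
  have h2 := Finset.sum_le_sum fun ℓ (_ : ℓ ∈ Finset.univ) => h ℓ
  simpa using h2

/-- The new block is an average of the `v j`, each within `C * γ t` of `x j`; so the increment is
controlled by the step-size and the disagreement. -/
theorem summable_sq_x_succ_sub (S : Admissible P ft G blk A γ R) (i : Fin N) :
    Summable fun t => ‖R.x (t + 1) i - R.x t i‖ ^ 2 := by
  obtain ⟨C, hC0, hC⟩ := S.exists_dir_bound
  refine summable_sq_of_le (summable_sq_const_mul (summable_sq_sum Finset.univ fun j _ =>
    summable_sq_add (summable_sq_const_mul S.step.sum_sq C) (S.summable_sq_x_sub_x j i)) B)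
    fun t => ?_
  rw [abs_of_nonneg (norm_nonneg _)]
  refine (norm_le_sum_block _).trans ?_
  have h : ∀ ℓ, ‖R.x (t + 1) i ℓ - R.x t i ℓ‖ ≤ ∑ j, (C * γ t + ‖R.x t j - R.x t i‖) := fun ℓ => by
    have h1 : R.x (t + 1) i ℓ - R.x t i ℓ
        = ∑ j, R.avgWeights A ℓ t i j • (R.v t j ℓ - R.x t i ℓ) := by
      simp only [smul_sub, Finset.sum_sub_distrib, ← Finset.sum_smul,
        S.avgWeights_rowStochastic ℓ t i, one_smul, S.x_succ]
    rw [h1]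
    refine norm_sum_le_of_le _ fun j _ => ?_
    rw [norm_smul, Real.norm_of_nonneg (S.avgWeights_nonneg _ _ _ _)]
    refine (mul_le_of_le_one_left (norm_nonneg _) (S.avgWeights_le_one _ _ _ _)).trans ?_
    rw [← sub_add_sub_cancel _ (R.x t j ℓ)]
    refine norm_add_le_of_le ((S.norm_v_sub_x_le _ _ _).trans ?_)
      (norm_block_le (R.x t j - R.x t i) ℓ)
    rw [mul_comm]
    exact mul_le_mul_of_nonneg_right (hC t j) (S.step.pos t).le
  have h2 := Finset.sum_le_sum fun ℓ (_ : ℓ ∈ Finset.univ) => h ℓ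
  simpa using h2

/-- The mixing of the `y` is perturbed by gradient increments, which the Lipschitz bound reduces to
increments of the `x`. -/
theorem summable_sq_y_sub_y (S : Admissible P ft G blk A γ R) (i j : Fin N) (ℓ : Fin B) :
    Summable fun t => ‖R.y t i ℓ - R.y t j ℓ‖ ^ 2 := by
  have := S.nonempty
  obtain ⟨L, hL⟩ := S.problem.exists_lipschitz
  obtain ⟨c, hc, hφ⟩ := S.exists_φ_lower_bound
  obtain ⟨κ, T, hW⟩ := S.avgWeights_jointlyPositive ℓ
  refine hW.summable_sq_norm_sub S.graph (S.avgWeights_rowStochastic ℓ)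
    (u := fun t i => R.y t i ℓ) (fun t i => ?_) (summable_sq_const_mul
      (summable_sq_sum Finset.univ fun i _ => S.summable_sq_x_succ_sub i) (c⁻¹ * L)) i j
  simp only [S.y_succ, add_sub_cancel_left]
  rw [norm_smul, Real.norm_of_nonneg (inv_pos.2 (S.φ_pos _ _ _)).le, mul_assoc]
  refine mul_le_mul (inv_anti₀ hc (hφ _ _ _)) ?_ (norm_nonneg _) (inv_pos.2 hc).le
  refine (Problem.norm_gradient_sub_le (hL i) (S.x_mem _ _) (S.x_mem _ _) ℓ).trans ?_
  exact mul_le_mul_of_nonneg_left (Finset.single_le_sum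
    (f := fun i => ‖R.x (t + 1) i - R.x t i‖) (fun _ _ => norm_nonneg _) (Finset.mem_univ i)) L.2

/-- The agents asymptotically track the gradient of the sum of the `f i` at the average. -/
theorem summable_sq_tracking (S : Admissible P ft G blk A γ R) (i : Fin N) (ℓ : Fin B) :
    Summable fun t => ‖P.gradF (R.zbar t) ℓ
      - (gradient (P.f i) (R.x t i) ℓ + R.π t i ℓ)‖ ^ 2 := by
  obtain ⟨L, hL⟩ := S.problem.exists_lipschitz
  -- Dropping the term at `0` discards the arbitrary initial `π`.
  rw [← summable_nat_add_iff 1]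
  refine summable_sq_of_le (summable_sq_shift (summable_sq_add
    (summable_sq_const_mul (summable_sq_sum Finset.univ fun j _ => S.summable_sq_x_sub_zbar j) L)
    (summable_sq_const_mul
      (summable_sq_sum Finset.univ fun j _ => S.summable_sq_y_sub_y i j ℓ) N)) 1) fun t => ?_
  rw [abs_of_nonneg (norm_nonneg _), S.run.π_succ, add_sub_cancel, Problem.gradF_block]
  have h1 : (N : ℝ) • R.y (t + 1) i ℓ = ∑ j, R.φ (t + 1) j ℓ • (R.y (t + 1) i ℓ - R.y (t + 1) j ℓ)
      + ∑ j, gradient (P.f j) (R.x (t + 1) j) ℓ := by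
    rw [← S.sum_φ_y]
    simp only [smul_sub, Finset.sum_sub_distrib, ← Finset.sum_smul, S.sum_φ, sub_add_cancel]
  rw [h1, sub_add_eq_sub_sub_swap, ← Finset.sum_sub_distrib, sub_eq_add_neg]
  refine norm_add_le_of_le ?_ ?_
  · rw [Finset.mul_sum]
    refine norm_sum_le_of_le _ fun j _ => ?_
    rw [norm_sub_rev]
    exact Problem.norm_gradient_sub_le (hL j) (S.x_mem _ _) (S.zbar_mem _) ℓ
  · rw [norm_neg, Finset.mul_sum]
    refine norm_sum_le_of_le _ fun j _ => ?_
    rw [norm_smul, Real.norm_of_nonneg (S.φ_pos _ _ _).le]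
    exact mul_le_mul_of_nonneg_right (S.φ_le _ _ _) (norm_nonneg _)

theorem exists_zbar_step_bound (S : Admissible P ft G blk A γ R) :
    ∃ C, 0 < C ∧ ∀ t, ‖R.zbar (t + 1) - R.zbar t‖ ≤ C * γ t := by
  obtain ⟨C, hC0, hC⟩ := S.exists_dir_bound
  -- `B + 1` keeps the constant positive even for `B = 0`.
  refine ⟨(B + 1) * C, by positivity, fun t => (norm_le_sum_block _).trans ?_⟩
  have h : ∀ ℓ, ‖R.zbar (t + 1) ℓ - R.zbar t ℓ‖ ≤ C * γ t := fun ℓ => by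
    have h1 : ∑ i, ((N : ℝ)⁻¹ * R.φ t i ℓ) * (C * γ t) = C * γ t := by
      rw [← Finset.sum_mul, S.sum_avg_φ, one_mul]
    rw [S.zbar_succ_sub, ← h1]
    refine norm_sum_le_of_le _ fun i _ => ?_
    rw [norm_smul, Real.norm_of_nonneg (S.avg_φ_nonneg _ _ _)]
    refine mul_le_mul_of_nonneg_left ((S.norm_v_sub_x_le _ _ _).trans ?_) (S.avg_φ_nonneg _ _ _)
    rw [mul_comm]
    exact mul_le_mul_of_nonneg_right (hC t i) (S.step.pos t).le
  have h2 := Finset.sum_le_sum fun ℓ (_ : ℓ ∈ Finset.univ) => h ℓ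
  rw [Finset.sum_const, Finset.card_univ, Fintype.card_fin, nsmul_eq_mul] at h2
  refine h2.trans ?_
  have := mul_pos hC0 (S.step.pos t)
  nlinarith

end Admissible

/-! ### Descent of the objective -/

theorem Problem.Assumptions.gradF_descent {N B d : ℕ} {P : Problem N B d} (h : P.Assumptions) :
    ∃ C, 0 < C ∧ ∀ x ∈ P.feasible, ∀ y ∈ P.feasible,
      ∑ i, P.f i y ≤ ∑ i, P.f i x + ⟪P.gradF x, y - x⟫_ℝ + C * ‖y - x‖ ^ 2 := by
  obtain ⟨L, hL⟩ := h.exists_lipschitz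
  refine ⟨N * L + 1, by positivity, fun x hx y hy => ?_⟩
  have h1 := Finset.sum_le_sum fun i (_ : i ∈ Finset.univ) =>
    le_add_inner_gradient_add_sq h.convex_feasible (h.differentiableAt i) (hL i) hx hy
  rw [Finset.sum_add_distrib, Finset.sum_add_distrib, ← sum_inner] at h1
  simp only [Finset.sum_const, Finset.card_univ, Fintype.card_fin, nsmul_eq_mul] at h1
  rw [Problem.gradF]
  nlinarith [sq_nonneg ‖y - x‖]

theorem Problem.Assumptions.exists_U_lipschitz {N B d : ℕ} {P : Problem N B d}
    (h : P.Assumptions) : ∃ C, 0 < C ∧ ∀ x ∈ P.feasible, ∀ y ∈ P.feasible,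
      |P.U y - P.U x| ≤ C * ‖y - x‖ := by
  obtain ⟨Cf, hCf, hf⟩ := h.exists_grad_bound
  obtain ⟨Cg, hCg, hg⟩ := h.exists_g_lipschitz
  refine ⟨N * Cf + B * Cg + 1, by positivity, fun x hx y hy => ?_⟩
  have h1 : P.U y - P.U x
      = ∑ i, (P.f i y - P.f i x) + ∑ ℓ, (P.g ℓ (y ℓ) - P.g ℓ (x ℓ)) := by
    simp only [Problem.U, Finset.sum_sub_distrib]
    ring
  have h2 : |∑ i, (P.f i y - P.f i x)| ≤ ∑ _i : Fin N, Cf * ‖y - x‖ :=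
    (Finset.abs_sum_le_sum_abs _ _).trans (Finset.sum_le_sum fun i _ =>
      abs_sub_le_of_gradient_bounded h.convex_feasible (h.differentiableAt i) (hf i) hx hy)
  have h3 : |∑ ℓ, (P.g ℓ (y ℓ) - P.g ℓ (x ℓ))| ≤ ∑ _ℓ : Fin B, Cg * ‖y - x‖ :=
    (Finset.abs_sum_le_sum_abs _ _).trans (Finset.sum_le_sum fun ℓ _ =>
      (hg ℓ _ (hx ℓ) _ (hy ℓ)).trans
        (mul_le_mul_of_nonneg_left (norm_block_le (y - x) ℓ) hCg.le))
  simp only [Finset.sum_const, Finset.card_univ, Fintype.card_fin, nsmul_eq_mul] at h2 h3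
  rw [h1]
  refine (abs_add_le _ _).trans ?_
  linarith [norm_nonneg (y - x)]

theorem Problem.Assumptions.isBounded_sublevel {N B d : ℕ} {P : Problem N B d}
    (h : P.Assumptions) (M : ℝ) : Bornology.IsBounded {x | x ∈ P.feasible ∧ P.U x ≤ M} := by
  have h1 := h.coercive.eventually (Filter.eventually_gt_atTop M)
  rw [Filter.eventually_inf_principal] at h1
  rw [← Bornology.isCobounded_compl_iff, Bornology.isCobounded_def]
  filter_upwards [h1] with x hx hx'
  exact (hx hx'.1).not_ge hx'.2

/-- The Lyapunov function: the smooth part of the objective is evaluated at the average, the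
nonsmooth part is averaged over the agents. -/
def lyapunov {N B d : ℕ} (P : Problem N B d) (R : Run N B d) (t : ℕ) : ℝ :=
  ∑ i, P.f i (R.zbar t) + ∑ i, ∑ ℓ, ((N : ℝ)⁻¹ * R.φ t i ℓ) * P.g ℓ (R.x t i ℓ)

namespace Admissible

variable {N B d : ℕ} {P : Problem N B d} {ft : Fin N → Fin B → Blk d → Var B d → ℝ}
  {G : Digraph (Fin N)} {blk : ℕ → Fin N → Fin B} {A : ℕ → Fin B → Matrix (Fin N) (Fin N) ℝ}
  {γ : ℕ → ℝ} {R : Run N B d}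

/-- Jensen's inequality for each `g ℓ` at the average. -/
theorem U_le_lyapunov (S : Admissible P ft G blk A γ R) (t : ℕ) :
    P.U (R.zbar t) ≤ lyapunov P R t := by
  rw [Problem.U, lyapunov, Finset.sum_comm]
  refine add_le_add le_rfl (Finset.sum_le_sum fun ℓ _ => ?_)
  rw [zbar_block]
  simpa using (S.problem.g_convexOn ℓ).map_sum_le (t := Finset.univ)
    (fun i _ => S.avg_φ_nonneg t i ℓ) (S.sum_avg_φ t ℓ) (fun i _ => S.x_mem t i ℓ)

/-- The reason for averaging the nonsmooth part over the agents: by Jensen's inequality and column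
stochasticity, the mixing step cannot increase it. -/
theorem sum_g_succ_le (S : Admissible P ft G blk A γ R) (t : ℕ) :
    ∑ i, ∑ ℓ, ((N : ℝ)⁻¹ * R.φ (t + 1) i ℓ) * P.g ℓ (R.x (t + 1) i ℓ)
      ≤ ∑ i, ∑ ℓ, ((N : ℝ)⁻¹ * R.φ t i ℓ) * P.g ℓ (R.v t i ℓ) := by
  rw [Finset.sum_comm, Finset.sum_comm (f := fun i ℓ => ((N : ℝ)⁻¹ * R.φ t i ℓ) * _)]
  refine Finset.sum_le_sum fun ℓ _ => ?_
  have h1 : ∀ i, ((N : ℝ)⁻¹ * R.φ (t + 1) i ℓ) * P.g ℓ (R.x (t + 1) i ℓ)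
      ≤ ∑ j, (N : ℝ)⁻¹ * (A t ℓ i j * R.φ t j ℓ * P.g ℓ (R.v t j ℓ)) := fun i => by
    have h2 := (S.problem.g_convexOn ℓ).map_sum_le (t := Finset.univ)
      (fun j _ => S.avgWeights_nonneg ℓ t i j) (S.avgWeights_rowStochastic ℓ t i)
      (fun j _ => S.v_mem t j ℓ)
    rw [← S.x_succ] at h2
    refine (mul_le_mul_of_nonneg_left h2 (S.avg_φ_nonneg _ _ _)).trans (le_of_eq ?_)
    rw [Finset.mul_sum]
    refine Finset.sum_congr rfl fun j _ => ?_
    have := (S.φ_pos (t + 1) i ℓ).ne'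
    simp only [Run.avgWeights, smul_eq_mul]
    field_simp
  refine (Finset.sum_le_sum fun i _ => h1 i).trans (le_of_eq ?_)
  rw [Finset.sum_comm]
  refine Finset.sum_congr rfl fun j _ => ?_
  rw [← Finset.mul_sum, ← Finset.sum_mul, ← Finset.sum_mul, S.column t ℓ, one_mul, mul_assoc]

theorem inner_gradF_step (S : Admissible P ft G blk A γ R) (t : ℕ) :
    ⟪P.gradF (R.zbar t), R.zbar (t + 1) - R.zbar t⟫_ℝ = ∑ i, ∑ ℓ, ((N : ℝ)⁻¹ * R.φ t i ℓ) *
      ⟪P.gradF (R.zbar t) ℓ, R.v t i ℓ - R.x t i ℓ⟫_ℝ := by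
  rw [PiLp.inner_apply, Finset.sum_comm]
  refine Finset.sum_congr rfl fun ℓ _ => ?_
  rw [PiLp.sub_apply, S.zbar_succ_sub, inner_sum]
  simp only [real_inner_smul_right]

/-- Decrease of the model of one block of one agent. -/
theorem exists_block_decrease (S : Admissible P ft G blk A γ R) (i : Fin N) :
    ∃ τ C, 0 < τ ∧ 0 < C ∧ ∀ t ℓ,
      ⟪P.gradF (R.zbar t) ℓ, R.v t i ℓ - R.x t i ℓ⟫_ℝ + P.g ℓ (R.v t i ℓ) - P.g ℓ (R.x t i ℓ)
        ≤ γ t * (C * ‖P.gradF (R.zbar t) ℓ - (gradient (P.f i) (R.x t i) ℓ + R.π t i ℓ)‖)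
          - (if ℓ = blk t i then γ t * (τ * ‖R.dir blk t i‖ ^ 2) else 0) := by
  obtain ⟨τ, hτ, hconv⟩ := S.surrogate.strongConvex i
  obtain ⟨C, hC0, hC⟩ := S.exists_dir_bound
  refine ⟨τ / 2, C, by positivity, hC0, fun t ℓ => ?_⟩
  have hγ := S.step.pos t
  by_cases hℓ : ℓ = blk t i
  · subst hℓ
    rw [if_pos rfl]
    set ℓ := blk t i
    obtain ⟨D, hD, hDg, -⟩ := S.surrogate.grad i ℓ
    have h1 : ⟪D (R.x t i ℓ) (R.x t i) + R.π t i ℓ, R.dir blk t i⟫_ℝ + P.g ℓ (R.xt t i)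
        - P.g ℓ (R.x t i ℓ) ≤ -(τ / 2 * ‖R.dir blk t i‖ ^ 2) :=
      inner_add_sub_le_of_isMinOn hτ.le (hconv ℓ _ (S.x_mem t i)) (S.problem.g_convexOn ℓ)
        (S.x_mem t i ℓ) (S.run.xt_mem t i) (hD _ (S.x_mem t i) _ (S.x_mem t i ℓ))
        (S.run.xt_min t i)
    rw [hDg _ (S.x_mem t i)] at h1
    set p := gradient (P.f i) (R.x t i) ℓ + R.π t i ℓ
    have h2 : P.g ℓ (R.v t i ℓ) - P.g ℓ (R.x t i ℓ)
        ≤ γ t * (P.g ℓ (R.xt t i) - P.g ℓ (R.x t i ℓ)) := by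
      have h3 := (S.problem.g_convexOn ℓ).2 (S.x_mem t i ℓ) (S.run.xt_mem t i)
        (sub_nonneg.2 (S.step.le_one t)) hγ.le (sub_add_cancel 1 _)
      have h4 : R.v t i ℓ = (1 - γ t) • R.x t i ℓ + γ t • R.xt t i := by
        rw [S.run.v_selected, smul_sub, sub_smul, one_smul]; abel
      rw [← h4] at h3
      simp only [smul_eq_mul] at h3
      linarith
    -- Replacing the true gradient by the agent's estimate `p` costs the tracking error times the
    -- bound `C` on the direction.
    have h5 : ⟪P.gradF (R.zbar t) ℓ, R.dir blk t i⟫_ℝ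
        ≤ C * ‖P.gradF (R.zbar t) ℓ - p‖ + ⟪p, R.dir blk t i⟫_ℝ := by
      have h6 := real_inner_le_norm (P.gradF (R.zbar t) ℓ - p) (R.dir blk t i)
      have h7 := mul_le_mul_of_nonneg_left (hC t i) (norm_nonneg (P.gradF (R.zbar t) ℓ - p))
      rw [inner_sub_left] at h6
      linarith
    rw [S.v_sub_x_selected, real_inner_smul_right]
    have h8 := mul_le_mul_of_nonneg_left
      (show ⟪P.gradF (R.zbar t) ℓ, R.dir blk t i⟫_ℝ + (P.g ℓ (R.xt t i) - P.g ℓ (R.x t i ℓ))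
        ≤ C * ‖P.gradF (R.zbar t) ℓ - p‖ - τ / 2 * ‖R.dir blk t i‖ ^ 2 by linarith) hγ.le
    linarith
  · rw [if_neg hℓ, S.run.v_other t i ℓ hℓ, sub_self, inner_zero_right, zero_add, sub_self, sub_zero]
    positivity

/-- The Lyapunov function decreases up to a summable error. -/
theorem exists_lyapunov_descent (S : Admissible P ft G blk A γ R) :
    ∃ (κ : ℝ) (c : ℕ → ℝ), 0 < κ ∧ (∀ t, 0 ≤ c t) ∧ Summable c ∧ ∀ t,
      lyapunov P R (t + 1) ≤ lyapunov P R t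
        - ∑ i, κ * (γ t * ‖R.dir blk t i‖ ^ 2) + c t := by
  obtain ⟨Cf, hCf, hdesc⟩ := S.problem.gradF_descent
  obtain ⟨Cz, hCz, hz⟩ := S.exists_zbar_step_bound
  obtain ⟨φ₀, hφ₀, hφ⟩ := S.exists_φ_lower_bound
  choose τ C hτ hC hdec using S.exists_block_decrease
  obtain ⟨ρ, hρ, hρτ⟩ := exists_uniform_bound (p := fun i (_ : Unit) => (τ i)⁻¹)
    fun i => ⟨(τ i)⁻¹, fun _ => le_rfl⟩
  have hτρ : ∀ i, ρ⁻¹ ≤ τ i := fun i => inv_le_of_inv_le₀ (hτ i) (hρτ i ())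
  set err : Fin N → Fin B → ℕ → ℝ := fun i ℓ t =>
    ‖P.gradF (R.zbar t) ℓ - (gradient (P.f i) (R.x t i) ℓ + R.π t i ℓ)‖ with herr
  refine ⟨(N : ℝ)⁻¹ * φ₀ * ρ⁻¹,
    fun t => ∑ i, ∑ ℓ, γ t * (C i * err i ℓ t) + Cf * (Cz * γ t) ^ 2, ?_, fun t => ?_, ?_,
    fun t => ?_⟩
  · have := S.cast_pos
    positivity
  · have := (S.step.pos t).le
    have hC' := fun i => (hC i).le
    have : ∀ i ℓ, 0 ≤ γ t * (C i * err i ℓ t) := fun i ℓ =>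
      mul_nonneg this (mul_nonneg (hC' i) (norm_nonneg _))
    exact add_nonneg (Finset.sum_nonneg fun i _ => Finset.sum_nonneg fun ℓ _ => this i ℓ)
      (by positivity)
  -- The step-size and the tracking error are both square-summable, so their product is summable.
  · refine Summable.add (summable_sum fun i _ => summable_sum fun ℓ _ => ?_)
      ((summable_sq_const_mul S.step.sum_sq Cz).mul_left Cf)
    exact summable_mul_of_sq S.step.sum_sq
      (summable_sq_const_mul (S.summable_sq_tracking i ℓ) (C i))
  · have h1 := hdesc _ (S.zbar_mem t) _ (S.zbar_mem (t + 1))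
    rw [S.inner_gradF_step] at h1
    have h2 := S.sum_g_succ_le t
    have h3 : Cf * ‖R.zbar (t + 1) - R.zbar t‖ ^ 2 ≤ Cf * (Cz * γ t) ^ 2 :=
      mul_le_mul_of_nonneg_left (pow_le_pow_left₀ (norm_nonneg _) (hz t) 2) hCf.le
    -- The weight `φ / N` is bounded above by `1` on the error and below by `φ₀ / N` on the
    -- decrease.
    have h4 : ∑ i, ∑ ℓ, ((N : ℝ)⁻¹ * R.φ t i ℓ) *
        (⟪P.gradF (R.zbar t) ℓ, R.v t i ℓ - R.x t i ℓ⟫_ℝ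
          + P.g ℓ (R.v t i ℓ) - P.g ℓ (R.x t i ℓ))
        ≤ ∑ i, ∑ ℓ, (γ t * (C i * err i ℓ t) - (if ℓ = blk t i then
          (N : ℝ)⁻¹ * φ₀ * ρ⁻¹ * (γ t * ‖R.dir blk t i‖ ^ 2) else 0)) := by
      refine Finset.sum_le_sum fun i _ => Finset.sum_le_sum fun ℓ _ => ?_
      refine (mul_le_mul_of_nonneg_left (hdec i t ℓ) (S.avg_φ_nonneg t i ℓ)).trans ?_
      rw [mul_sub]
      refine sub_le_sub (mul_le_of_le_one_left (mul_nonneg (S.step.pos t).le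
        (mul_nonneg (hC i).le (norm_nonneg _))) (S.avg_φ_le_one t i ℓ)) ?_
      split_ifs
      · have h5 : (N : ℝ)⁻¹ * φ₀ * ρ⁻¹ ≤ (N : ℝ)⁻¹ * R.φ t i ℓ * τ i :=
          mul_le_mul (mul_le_mul_of_nonneg_left (hφ t i ℓ) (inv_pos.2 S.cast_pos).le) (hτρ i)
            (inv_pos.2 hρ).le (S.avg_φ_nonneg t i ℓ)
        have h6 := mul_le_mul_of_nonneg_right h5
          (mul_nonneg (S.step.pos t).le (sq_nonneg ‖R.dir blk t i‖))
        linarith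
      · rw [mul_zero]
    simp only [mul_sub, mul_add, Finset.sum_sub_distrib, Finset.sum_add_distrib,
      Finset.sum_ite_eq', Finset.mem_univ, if_true] at h4
    rw [lyapunov, lyapunov]
    linarith

/-- The telescoped descent keeps `zbar` in a sublevel set of `U`, bounded by coercivity. On a
bounded set the Lipschitz `U` is bounded below, so the total decrease is finite. -/
theorem lyapunov_bounds (S : Admissible P ft G blk A γ R) :
    Bornology.IsBounded (Set.range R.zbar) ∧
      ∀ i, Summable fun t => γ t * ‖R.dir blk t i‖ ^ 2 := by
  obtain ⟨κ, c, hκ, hc0, hc, hdesc⟩ := S.exists_lyapunov_descent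
  have hnn : ∀ i t, 0 ≤ γ t * ‖R.dir blk t i‖ ^ 2 := fun i t =>
    mul_nonneg (S.step.pos t).le (sq_nonneg _)
  have hnn' : ∀ t, 0 ≤ ∑ i, κ * (γ t * ‖R.dir blk t i‖ ^ 2) := fun t =>
    Finset.sum_nonneg fun i _ => mul_nonneg hκ.le (hnn i t)
  have hmain := le_of_perturbed_descent hc0 hc hdesc
  set M := lyapunov P R 0 + ∑' t, c t
  have hbdd : Bornology.IsBounded (Set.range R.zbar) := by
    refine (S.problem.isBounded_sublevel M).subset ?_
    rintro _ ⟨t, rfl⟩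
    have := Finset.sum_nonneg fun s (_ : s ∈ Finset.range t) => hnn' s
    exact ⟨S.zbar_mem t, (S.U_le_lyapunov t).trans (by linarith [hmain t])⟩
  refine ⟨hbdd, fun i => ?_⟩
  obtain ⟨C, hC0, hC⟩ := S.problem.exists_U_lipschitz
  obtain ⟨r, hr⟩ := Metric.isBounded_iff.1 hbdd
  have hlow : ∀ t, P.U (R.zbar 0) - C * r ≤ P.U (R.zbar t) := fun t => by
    have h1 := (abs_le.1 (hC _ (S.zbar_mem 0) _ (S.zbar_mem t))).1
    have h2 := hr (Set.mem_range_self t) (Set.mem_range_self 0)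
    rw [dist_eq_norm] at h2
    linarith [mul_le_mul_of_nonneg_left h2 hC0.le]
  refine summable_of_sum_range_le (c := κ⁻¹ * (M - (P.U (R.zbar 0) - C * r))) (hnn i) fun n => ?_
  have h1 : κ * ∑ t ∈ Finset.range n, γ t * ‖R.dir blk t i‖ ^ 2
      ≤ ∑ t ∈ Finset.range n, ∑ i, κ * (γ t * ‖R.dir blk t i‖ ^ 2) := by
    rw [Finset.mul_sum]
    exact Finset.sum_le_sum fun t _ => Finset.single_le_sum
      (f := fun i => κ * (γ t * ‖R.dir blk t i‖ ^ 2))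
      (fun j _ => mul_nonneg hκ.le (hnn j t)) (Finset.mem_univ i)
  rw [← div_eq_inv_mul, le_div_iff₀ hκ]
  linarith [hmain n, S.U_le_lyapunov n, hlow n]

/-! ### Stationarity of the limit points -/

/-- The exact best responses of agent `i` in block `ℓ`: they depend on the point in a Lipschitz
way and are approximated by the minimizers of the algorithm. -/
theorem exists_bestResponse (S : Admissible P ft G blk A γ R) (i : Fin N) (ℓ : Fin B) :
    ∃ (br : Var B d → Blk d) (C : ℝ), 0 < C ∧
      (∀ z ∈ P.feasible, ∀ z' ∈ P.feasible, ‖br z - br z'‖ ≤ C * ‖z - z'‖) ∧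
      (∀ t, blk t i = ℓ → ‖R.xt t i - br (R.zbar t)‖ ≤ C * (‖R.x t i - R.zbar t‖
        + ‖P.gradF (R.zbar t) ℓ - (gradient (P.f i) (R.x t i) ℓ + R.π t i ℓ)‖)) ∧
      ∀ z ∈ P.feasible, br z = z ℓ →
        ∀ w ∈ P.K ℓ, 0 ≤ ⟪P.gradF z ℓ, w - z ℓ⟫_ℝ + P.g ℓ w - P.g ℓ (z ℓ) := by
  obtain ⟨L, hL⟩ := S.problem.exists_lipschitz
  obtain ⟨Cg, hCg, hg⟩ := S.problem.exists_g_lipschitz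
  obtain ⟨τ, hτ, hconv⟩ := S.surrogate.strongConvex i
  obtain ⟨D, hD, hDg, LD, hLD⟩ := S.surrogate.grad i ℓ
  have hD' : ∀ z ∈ P.feasible, ∀ z' ∈ P.feasible, ∀ u ∈ P.K ℓ,
      ‖D u z - D u z'‖ ≤ LD * ‖z - z'‖ := fun z hz z' hz' u hu => by
    have := (hLD u hu).dist_le_mul z hz z' hz'
    rwa [dist_eq_norm, dist_eq_norm] at this
  have hgF : ∀ z ∈ P.feasible, ∀ z' ∈ P.feasible,
      ‖P.gradF z ℓ - P.gradF z' ℓ‖ ≤ N * (L * ‖z - z'‖) := fun z hz z' hz' => by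
    rw [Problem.gradF_block, Problem.gradF_block, ← Finset.sum_sub_distrib]
    have : ‖∑ j, (gradient (P.f j) z ℓ - gradient (P.f j) z' ℓ)‖ ≤ ∑ _j : Fin N, L * ‖z - z'‖ :=
      norm_sum_le_of_le _ fun j _ => Problem.norm_gradient_sub_le (hL j) hz hz' ℓ
    simpa using this
  -- The best response is wanted as a total function; its value off the feasible set is a dummy `0`.
  have hex : ∀ z : Var B d, ∃ u, z ∈ P.feasible → u ∈ P.K ℓ ∧
      IsMinOn (fun u => ft i ℓ u z + ⟪u - z ℓ, P.gradF z ℓ - gradient (P.f i) z ℓ⟫_ℝ + P.g ℓ u)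
        (P.K ℓ) u := fun z => by
    by_cases hz : z ∈ P.feasible
    · obtain ⟨u, hu, hmin⟩ := exists_isMinOn (p := P.gradF z ℓ - gradient (P.f i) z ℓ) hτ
        (S.problem.closed ℓ) (hconv ℓ z hz)
        (((S.problem.g_convex ℓ).continuousOn (S.problem.g_open ℓ)).mono (S.problem.g_subset ℓ))
        (hz ℓ) (hD z hz) fun u hu => hg ℓ _ (hz ℓ) _ hu
      exact ⟨u, fun _ => ⟨hu, hmin⟩⟩
    · exact ⟨0, fun h => absurd h hz⟩
  choose br hbr using hex
  have hLD0 : (0 : ℝ) ≤ LD := LD.2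
  have hL0 : (0 : ℝ) ≤ L := L.2
  have hN0 := S.cast_pos
  -- `LD`, `N * L` and `L` come from the surrogate gradient, `gradF` and the agent's own gradient;
  -- the `1` pays for the tracking error.
  refine ⟨br, 2 / τ * (LD + N * L + L + 1), by positivity, fun z hz z' hz' => ?_,
    fun t ht => ?_, fun z hz hbz w hw => ?_⟩
  · have h1 := norm_isMinOn_sub_le hτ (hconv ℓ z hz) (hconv ℓ z' hz') (S.problem.g_convexOn ℓ)
      (hD z hz) (hD z' hz') (hD' z hz z' hz') (hbr z hz).1 (hbr z' hz').1 (hbr z hz).2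
      (hbr z' hz').2
    refine h1.trans ?_
    rw [mul_assoc]
    refine mul_le_mul_of_nonneg_left ?_ (by positivity)
    rw [sub_sub_sub_comm]
    have h2 := norm_sub_le (P.gradF z ℓ - P.gradF z' ℓ)
      (gradient (P.f i) z ℓ - gradient (P.f i) z' ℓ)
    linarith [hgF z hz z' hz', Problem.norm_gradient_sub_le (hL i) hz hz' ℓ, norm_nonneg (z - z')]
  · subst ht
    have hx := S.x_mem t i
    have hz := S.zbar_mem t
    have h1 := norm_isMinOn_sub_le hτ (hconv _ _ hx) (hconv _ _ hz) (S.problem.g_convexOn _)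
      (hD _ hx) (hD _ hz) (hD' _ hx _ hz) (S.run.xt_mem t i) (hbr _ hz).1 (S.run.xt_min t i)
      (hbr _ hz).2
    refine h1.trans ?_
    rw [mul_assoc]
    refine mul_le_mul_of_nonneg_left ?_ (by positivity)
    set ℓ := blk t i
    have h2 : R.π t i ℓ - (P.gradF (R.zbar t) ℓ - gradient (P.f i) (R.zbar t) ℓ)
        = -(P.gradF (R.zbar t) ℓ - (gradient (P.f i) (R.x t i) ℓ + R.π t i ℓ))
          - (gradient (P.f i) (R.x t i) ℓ - gradient (P.f i) (R.zbar t) ℓ) := by abel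
    rw [h2]
    have h3 := norm_sub_le (-(P.gradF (R.zbar t) ℓ - (gradient (P.f i) (R.x t i) ℓ + R.π t i ℓ)))
      (gradient (P.f i) (R.x t i) ℓ - gradient (P.f i) (R.zbar t) ℓ)
    rw [norm_neg] at h3
    have h4 := Problem.norm_gradient_sub_le (hL i) hx hz ℓ
    set a := ‖R.x t i - R.zbar t‖
    set e := ‖P.gradF (R.zbar t) ℓ - (gradient (P.f i) (R.x t i) ℓ + R.π t i ℓ)‖
    have ha : 0 ≤ a := norm_nonneg _
    have he : 0 ≤ e := norm_nonneg _
    have h5 : 0 ≤ (N * L : ℝ) * a := by positivity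
    have h6 : 0 ≤ (LD + N * L + L : ℝ) * e := by positivity
    linarith
  · have hmin := (hbr z hz).2
    rw [hbz] at hmin
    have h1 := inner_add_sub_nonneg_of_isMinOn (S.problem.g_convexOn ℓ) (hz ℓ) hw
      (hD z hz _ (hz ℓ)) hmin
    rwa [hDg z hz, add_sub_cancel] at h1

/-- Lets the step-size at the start of a window be replaced by the one at the time in the window
when the block is selected. -/
theorem exists_decay (S : Admissible P ft G blk A γ R) :
    ∃ η, 0 < η ∧ ∀ t s, γ t ≤ (η ^ s)⁻¹ * γ (t + s) := by
  obtain ⟨η, hη, h⟩ := S.step.decay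
  refine ⟨η, hη.1, fun t s => ?_⟩
  rw [← div_eq_inv_mul, le_div_iff₀ (pow_pos hη.1 s)]
  induction s with
  | zero => simp
  | succ s ih =>
    refine le_trans ?_ (h (t + s)).1
    rw [pow_succ]
    nlinarith [hη.1]

theorem step_le (S : Admissible P ft G blk A γ R) (t s : ℕ) : γ (t + s) ≤ γ t := by
  obtain ⟨η, -, h⟩ := S.step.decay
  exact antitone_nat_of_succ_le (fun t => (h t).2) (Nat.le_add_right t s)

theorem isStationary_of_mapClusterPt (S : Admissible P ft G blk A γ R) {z : Var B d}
    (hz : MapClusterPt z Filter.atTop R.zbar) : P.IsStationary z := by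
  have hzmem : z ∈ P.feasible := S.problem.isClosed_feasible.mem_of_mapClusterPt hz
    (Filter.Eventually.of_forall S.zbar_mem)
  obtain ⟨i⟩ := S.nonempty
  obtain ⟨T, hT⟩ := S.exists_window
  obtain ⟨Cz, hCz, hstep⟩ := S.exists_zbar_step_bound
  obtain ⟨η, hη, hdecay⟩ := S.exists_decay
  have hVI : ∀ ℓ, ∀ w ∈ P.K ℓ, 0 ≤ ⟪P.gradF z ℓ, w - z ℓ⟫_ℝ + P.g ℓ w - P.g ℓ (z ℓ) := by
    intro ℓ
    obtain ⟨br, C, hC, hlip, happrox, hstat⟩ := S.exists_bestResponse i ℓ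
    refine hstat z hzmem ?_
    set m : Var B d → ℝ := fun x => ‖br x - x ℓ‖ with hm
    have hmlip : ∀ x ∈ P.feasible, ∀ y ∈ P.feasible, |m x - m y| ≤ (C + 1) * ‖x - y‖ := by
      intro x hx y hy
      refine (abs_norm_sub_norm_le _ _).trans ?_
      rw [sub_sub_sub_comm]
      refine (norm_sub_le _ _).trans ?_
      have h1 : ‖x ℓ - y ℓ‖ ≤ ‖x - y‖ := norm_block_le (x - y) ℓ
      linarith [hlip x hx y hy]
    have hvar : ∀ t, |m (R.zbar (t + 1)) - m (R.zbar t)| ≤ (C + 1) * Cz * γ t := fun t => by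
      rw [mul_assoc]
      exact (hmlip _ (S.zbar_mem _) _ (S.zbar_mem _)).trans
        (mul_le_mul_of_nonneg_left (hstep t) (by positivity))
    set e : ℕ → ℝ := fun t => (C + 1) * (‖R.x t i - R.zbar t‖
      + ‖P.gradF (R.zbar t) ℓ - (gradient (P.f i) (R.x t i) ℓ + R.π t i ℓ)‖)
    have he0 : ∀ t, 0 ≤ e t := fun t => by positivity
    have he : Summable fun t => e t ^ 2 := summable_sq_const_mul
      (summable_sq_add (S.summable_sq_x_sub_zbar i) (S.summable_sq_tracking i ℓ)) _
    -- When the block is selected, the residual differs from the actual direction only by consensus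
    -- and tracking errors.
    have hsel : ∀ t, blk t i = ℓ → m (R.zbar t) ≤ ‖R.dir blk t i‖ + e t := by
      intro t ht
      have h1 := happrox t ht
      have h2 : br (R.zbar t) - R.zbar t ℓ = R.dir blk t i - (R.xt t i - br (R.zbar t))
          + (R.x t i - R.zbar t) ℓ := by
        rw [Run.dir, ht, PiLp.sub_apply]; abel
      have h3 := norm_add_le (R.dir blk t i - (R.xt t i - br (R.zbar t))) ((R.x t i - R.zbar t) ℓ)
      have h4 := norm_sub_le (R.dir blk t i) (R.xt t i - br (R.zbar t))
      have h5 := norm_block_le (R.x t i - R.zbar t) ℓ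
      have h6 : 0 ≤ ‖P.gradF (R.zbar t) ℓ - (gradient (P.f i) (R.x t i) ℓ + R.π t i ℓ)‖ :=
        norm_nonneg _
      simp only [hm, e]
      rw [h2]
      linarith
    have hdrift : ∀ t s, m (R.zbar t) ≤ m (R.zbar (t + s)) + s * ((C + 1) * Cz * γ t) := by
      intro t s
      induction s with
      | zero => simp
      | succ s ih =>
        have h1 := (abs_le.1 (hvar (t + s))).1
        have h2 := mul_le_mul_of_nonneg_left (S.step_le t s)
          (show 0 ≤ (C + 1) * Cz by positivity)
        push_cast
        rw [← add_assoc]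
        linarith
    -- The selection time in the window is unknown, so the bound sums over the whole window and adds
    -- the drift of `m`.
    have hwin : ∀ t, m (R.zbar t) ≤ ∑ s ∈ Finset.range T, (‖R.dir blk (t + s) i‖ + e (t + s))
        + T * ((C + 1) * Cz) * γ t := by
      intro t
      obtain ⟨s, hs, hblk⟩ := hT t i ℓ
      have h1 := Finset.single_le_sum (f := fun s => ‖R.dir blk (t + s) i‖ + e (t + s))
        (fun s _ => add_nonneg (norm_nonneg _) (he0 _)) (Finset.mem_range.2 hs)
      have h2 : (s : ℝ) * ((C + 1) * Cz * γ t) ≤ T * ((C + 1) * Cz * γ t) := by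
        have := (S.step.pos t).le
        have : (s : ℝ) ≤ T := by exact_mod_cast hs.le
        gcongr
      linarith [hdrift t s, hsel _ hblk]
    -- Writing `γ m²` as `(√γ m)²` lets `hwin` be used term by term with square-summable sequences.
    have hsq : Summable fun t => (√(γ t) * m (R.zbar t)) ^ 2 := by
      have hdir : Summable fun t => (√(γ t) * ‖R.dir blk t i‖) ^ 2 := by
        refine (S.lyapunov_bounds.2 i).congr fun t => ?_
        rw [mul_pow, Real.sq_sqrt (S.step.pos t).le]
      refine summable_sq_of_le (summable_sq_add
        (summable_sq_sum (Finset.range T) fun s _ => summable_sq_add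
          (summable_sq_const_mul (summable_sq_shift hdir s) (√((η ^ s)⁻¹)))
          (summable_sq_shift he s))
        (summable_sq_const_mul S.step.sum_sq (T * ((C + 1) * Cz)))) fun t => ?_
      have hγ0 := (S.step.pos t).le
      have hs1 : √(γ t) ≤ 1 := Real.sqrt_le_one.2 (S.step.le_one t)
      rw [abs_of_nonneg (mul_nonneg (Real.sqrt_nonneg _) (norm_nonneg _))]
      refine (mul_le_mul_of_nonneg_left (hwin t) (Real.sqrt_nonneg _)).trans ?_
      rw [mul_add, Finset.mul_sum]
      refine add_le_add (Finset.sum_le_sum fun s _ => ?_)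
        (mul_le_of_le_one_left (by positivity) hs1)
      rw [mul_add, ← mul_assoc (√((η ^ s)⁻¹)), ← Real.sqrt_mul (by positivity)]
      refine add_le_add (mul_le_mul_of_nonneg_right (Real.sqrt_le_sqrt (hdecay t s))
        (norm_nonneg _)) (mul_le_of_le_one_left (he0 _) hs1)
    have hlim := tendsto_zero_of_slowly_varying (m := fun t => m (R.zbar t))
      (fun t => norm_nonneg _) (fun t => (S.step.pos t).le) S.step.le_one S.step.sum_sq
      S.step.sum_eq_top hvar (hsq.congr fun t => by
        rw [mul_pow, Real.sq_sqrt (S.step.pos t).le])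
    -- `m` is Lipschitz and tends to `0` along all of `zbar`, so it vanishes at every cluster point.
    have hm0 : m z ≤ 0 := by
      refine le_of_forall_pos_le_add fun ε hε => ?_
      have hδ : 0 < ε / (2 * (C + 1)) := by positivity
      obtain ⟨t, ht1, ht2⟩ := ((hz.frequently (Metric.ball_mem_nhds z hδ)).and_eventually
        (hlim.eventually (gt_mem_nhds (half_pos hε)))).exists
      have h1 := (abs_le.1 (hmlip _ hzmem _ (S.zbar_mem t))).2
      rw [dist_comm, dist_eq_norm, lt_div_iff₀ (by positivity)] at ht1
      linarith
    exact sub_eq_zero.1 (norm_le_zero_iff.1 hm0)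
  choose ξ hξ hξK using fun ℓ => exists_isSubgradientOn_inner_nonneg (S.problem.g_open ℓ)
    (S.problem.g_convex ℓ) (S.problem.convex ℓ) (S.problem.g_subset ℓ) (hzmem ℓ) (hVI ℓ)
  refine ⟨hzmem, WithLp.toLp 2 ξ, hξ, fun y hy => ?_⟩
  rw [PiLp.inner_apply]
  exact Finset.sum_nonneg fun ℓ _ => hξK ℓ (y ℓ) (hy ℓ)

end Admissible

end BlockSonata

end

theorem theorem2 {N B d : ℕ} (hN : 0 < N)
    (P : BlockSonata.Problem N B d)
    (ft : Fin N → Fin B → BlockSonata.Blk d → BlockSonata.Var B d → ℝ)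
    (G : Digraph (Fin N))
    (blk : ℕ → Fin N → Fin B)
    (A : ℕ → Fin B → Matrix (Fin N) (Fin N) ℝ)
    (γ : ℕ → ℝ)
    (R : BlockSonata.Run N B d)
    (hP : P.Assumptions)
    (hG : BlockSonata.StronglyConnected G)
    (hA : BlockSonata.WeightsMatch G blk A)
    (hcol : BlockSonata.ColumnStochastic A)
    (hblk : BlockSonata.EssentiallyCyclic blk)
    (hft : P.SurrogateAssumptions ft)
    (hγ : BlockSonata.StepSize γ)
    (hR : R.IsGenerated P ft G blk A γ) :
    (Bornology.IsBounded (Set.range R.zbar) ∧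
      ∀ z, MapClusterPt z Filter.atTop R.zbar → P.IsStationary z) ∧
    ∀ i, Filter.Tendsto (fun t => ‖R.x t i - R.zbar t‖) Filter.atTop (nhds 0) := by
  have S : BlockSonata.Admissible P ft G blk A γ R := ⟨hN, hP, hG, hA, hcol, hblk, hft, hγ, hR⟩
  exact ⟨⟨S.lyapunov_bounds.1, fun z => S.isStationary_of_mapClusterPt⟩,
    fun i => BlockSonata.tendsto_zero_of_summable_sq (S.summable_sq_x_sub_zbar i)⟩
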